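/- All Banach spaces are over the same scalar field, $\mathbb R$ or $\mathbb C$, and $B(X,Y)$ denotes the bounded linear operators from $X$ to $Y$. For $1\le r<\infty$ let $\Pi_r(X,Y)$ be the space of $r$-summing operators and $\pi_r$ the $r$-summing norm; $\Pi_\infty(X,Y)=B(X,Y)$ and $\pi_\infty$ is the operator norm. For $1\le p<\infty$, the strictly $p$-integral norm $i_p(T)$ of $T\in B(Z,Y)$ is the infimum of $\|A\|\,\|B\|$ over all probability measures $\mu$ and all factorizations $T=BjA$ with $A\in B(Z,L_\infty(\mu))$, $B\in B(L_p(\mu),Y)$ and $j\colon L_\infty(\mu)\to L_p(\mu)$ the formal inclusion. A Banach space $Y$ has $\mathrm{GL}(1,p)$ if there is a constant $K$ such that $i_p(T)\le K\,\pi_1(T^*)$ for every Banach space $Z$ and every finite rank operator $T\in Z^*\otimes Y$, $T\colon Z\to Y$; the smallest such $K$ is $\mathrm{GL}_{1,p}(Y)$. An operator $T\in B(X,Y)$ belongs to $\Gamma_p(X,Y)$ if $T=BA$ with $A\in B(X,L_p(\mu))$ and $B\in B(L_p(\mu),Y)$ for some measure $\mu$, and $\gamma_p(T)$ is the infimum of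 $\|A\|\,\|B\|$ over all such factorizations. **Theorem 3.1.** Let $1\le p\le 2$, let $q=p'$ be the conjugate exponent, $\frac1p+\frac1{p'}=1$, and let $X$ and $Y$ be Banach spaces. Assume that $B(\ell_\infty,X^*)=\Pi_{p'}(\ell_\infty,X^*)$ and that $Y$ has $\mathrm{GL}(1,p)$. Then there is a finite constant $C$ with $\pi_{p'}(U)\le C\|U\|$ for all $U\in B(\ell_\infty,X^*)$; let $C_q(X^*)$ be the smallest such constant. Moreover every $T\in B(X,Y)$, regarded as an operator from $X$ to $Y^{**}$ through the canonical embedding $Y\to Y^{**}$, belongs to $\Gamma_p(X,Y^{**})$, and $$\gamma_p(T)\le C_q(X^*)\,\mathrm{GL}_{1,p}(Y)\,\|T\|,$$ where $\gamma_p(T)$ is computed in $\Gamma_p(X,Y^{**})$. -/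

import Mathlib

open MeasureTheory
open scoped ENNReal NNReal

universe u v w

namespace BanachOp

noncomputable section

section Summing

variable {𝕜 : Type} [RCLike 𝕜]
  {X : Type v} [NormedAddCommGroup X] [NormedSpace 𝕜 X]
  {Y : Type w} [NormedAddCommGroup Y] [NormedSpace 𝕜 Y]

/-- The Banach space adjoint `T* : Y* → X*`, `T* g = g ∘ T`. -/
def adj (T : X →L[𝕜] Y) : StrongDual 𝕜 Y →L[𝕜] StrongDual 𝕜 X :=
  ContinuousLinearMap.precomp 𝕜 T

/-- `T : X → Y` regarded as an operator into `Y**` through the canonical embedding `Y → Y**`. -/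
def toBidual (T : X →L[𝕜] Y) : X →L[𝕜] StrongDual 𝕜 (StrongDual 𝕜 Y) :=
  ContinuousLinearMap.comp (NormedSpace.inclusionInDoubleDual 𝕜 Y) T

/-- The strong `ℓ_p` norm `(∑ ‖x i‖ ^ p) ^ (1 / p)` of a finite family, `1 ≤ p < ∞`. -/
def strongNorm (p : ℝ≥0∞) {n : ℕ} (x : Fin n → X) : ℝ≥0∞ :=
  (∑ i, ‖x i‖ₑ ^ p.toReal) ^ (1 / p.toReal)

variable (𝕜) in
/-- The weak `ℓ_p` norm of a finite family: the supremum over the unit ball of `X*` of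
`(∑ |f (x i)| ^ p) ^ (1 / p)`, `1 ≤ p < ∞`. -/
def weakNorm (p : ℝ≥0∞) {n : ℕ} (x : Fin n → X) : ℝ≥0∞ :=
  ⨆ (f : StrongDual 𝕜 X) (_ : ‖f‖ ≤ 1), strongNorm p (fun i => f (x i))

/-- The `p`-summing norm `π_p(T)`, with value `∞` if `T` is not `p`-summing;
`π_∞` is the operator norm. -/
def summingNorm (p : ℝ≥0∞) (T : X →L[𝕜] Y) : ℝ≥0∞ :=
  if p = ∞ then ‖T‖ₑ
  else ⨅ (K : ℝ≥0)
    (_ : ∀ (n : ℕ) (x : Fin n → X), strongNorm p (fun i => T (x i)) ≤ K * weakNorm 𝕜 p x),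
    (K : ℝ≥0∞)

/-- `T` belongs to `Π_p(X, Y)`. -/
def IsSumming (p : ℝ≥0∞) (T : X →L[𝕜] Y) : Prop :=
  summingNorm p T < ∞

variable (𝕜) in
/-- The Banach space `ℓ_∞` of bounded scalar sequences. -/
abbrev EllInfty : Type := lp (fun _ : ℕ => 𝕜) ∞

variable (𝕜 Y) in
/-- The smallest constant `C` with `π_q(U) ≤ C ‖U‖` for all `U ∈ B(ℓ_∞, Y)`
(`∞` if there is none). -/
def ellInftySummingConst (q : ℝ≥0∞) : ℝ≥0∞ :=
  ⨅ (C : ℝ≥0) (_ : ∀ U : EllInfty 𝕜 →L[𝕜] Y, summingNorm q U ≤ C * ‖U‖ₑ), (C : ℝ≥0∞)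

end Summing

section Factorization

variable {𝕜 : Type} [RCLike 𝕜]
  {X : Type u} [NormedAddCommGroup X] [NormedSpace 𝕜 X]
  {Y : Type u} [NormedAddCommGroup Y] [NormedSpace 𝕜 Y]

/-- The strictly `p`-integral norm `i_p(T)`, `1 ≤ p < ∞`: the infimum of `‖A‖ ‖B‖` over all
factorizations `T = B j A` with `A : X → L_∞(μ)`, `B : L_p(μ) → Y`, where `μ` is a probability
measure and `j : L_∞(μ) → L_p(μ)` is the formal inclusion. It is `∞` if there are none. -/
def strictIntegralNorm (p : ℝ≥0∞) [Fact (1 ≤ p)] (T : X →L[𝕜] Y) : ℝ≥0∞ :=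
  ⨅ (Ω : Type u) (_ : MeasurableSpace Ω) (μ : Measure Ω) (_ : IsProbabilityMeasure μ)
    (A : X →L[𝕜] Lp 𝕜 ∞ μ) (B : Lp 𝕜 p μ →L[𝕜] Y)
    (_ : ∀ x, T x = B (AddSubgroup.inclusion (Lp.antitone le_top) (A x))),
    ‖A‖ₑ * ‖B‖ₑ

/-- `T` belongs to `Γ_p(X, Y)`: it factors as `T = B A` through `L_p(μ)` for some measure `μ`. -/
def FactorsThroughLp (p : ℝ≥0∞) [Fact (1 ≤ p)] (T : X →L[𝕜] Y) : Prop :=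
  ∃ (Ω : Type u) (_ : MeasurableSpace Ω) (μ : Measure Ω)
    (A : X →L[𝕜] Lp 𝕜 p μ) (B : Lp 𝕜 p μ →L[𝕜] Y), T = B ∘L A

/-- `γ_p(T)`: the infimum of `‖A‖ ‖B‖` over all factorizations `T = B A` through some `L_p(μ)`. -/
def gammaNorm (p : ℝ≥0∞) [Fact (1 ≤ p)] (T : X →L[𝕜] Y) : ℝ≥0∞ :=
  ⨅ (Ω : Type u) (_ : MeasurableSpace Ω) (μ : Measure Ω)
    (A : X →L[𝕜] Lp 𝕜 p μ) (B : Lp 𝕜 p μ →L[𝕜] Y) (_ : T = B ∘L A),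
    ‖A‖ₑ * ‖B‖ₑ

variable (𝕜 Y) in
/-- `K` is admissible in the property `GL(p, q)` of `Y`: for every Banach space `Z` and every
finite rank operator `T ∈ Z* ⊗ Y`, `i_q(T) ≤ K π_p(T*)`. Here `1 ≤ p ≤ ∞`, `1 ≤ q < ∞`. -/
def GLBound (p q : ℝ≥0∞) [Fact (1 ≤ q)] (K : ℝ≥0) : Prop :=
  ∀ (Z : Type u) [NormedAddCommGroup Z] [NormedSpace 𝕜 Z] [CompleteSpace Z] (T : Z →L[𝕜] Y),
    FiniteDimensional 𝕜 (LinearMap.range T.toLinearMap) →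
      strictIntegralNorm q T ≤ K * summingNorm p (adj T)

variable (𝕜 Y) in
/-- The property `GL(p, q)`. -/
def HasGL (p q : ℝ≥0∞) [Fact (1 ≤ q)] : Prop :=
  ∃ K : ℝ≥0, GLBound 𝕜 Y p q K

variable (𝕜 Y) in
/-- The constant `GL_{p,q}(Y)`: the smallest admissible constant in `GL(p, q)`. -/
def GLConst (p q : ℝ≥0∞) [Fact (1 ≤ q)] : ℝ≥0∞ :=
  ⨅ (K : ℝ≥0) (_ : GLBound 𝕜 Y p q K), (K : ℝ≥0∞)

end Factorization

end

end BanachOp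

/-!
The argument has a local part, a convexity step, and a passage to the limit. Write `r` for the
exponent `p`, `q` for its conjugate and `C` for a constant with `π_q(U) ≤ C ‖U‖` for all operators
`U : ℓ_∞ → X*`; such a constant exists by uniform boundedness (`exists_summingNorm_le_mul_enorm`).

*Local part.* Let `w_1, …, w_m` be points of `X`, and let `Z` be their span with the quotient norm
of `ℓ_q^m`, so that the inclusion `S : Z → X` satisfies `|f (S z)| ≤ (∑ |f (w_j)| ^ r) ^ (1 / r) ‖z‖`
for `f ∈ X*`. Applying the `q`-summing inequality to operators `ℓ_∞ → X*` of the form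
`e_i ↦ T* (y_i)` shows that `π_1((T S)*) ≤ C ‖T‖ (∑ ‖w_j‖ ^ r) ^ (1 / r)`
(`summingNorm_adj_comp_le`). As `T S` has finite rank, the property `GL(1, p)` of `Y` provides a
factorization of `T S` through a formal inclusion `L_∞(μ) → L_p(μ)`, with control of the norms.
The image of the unit vectors in `L_p(μ)` has a strong `ℓ_r` bound because the inclusion is taken
on `L_∞(μ)`; approximating by simple functions, `T` is approximated at the `w_j` by maps
`∑ ξ_k ⊗ y_k` that factor through `ℓ_r^n`, where `a ↦ ∑ a_k y_k` has norm at most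
`c > K C ‖T‖` and `∑_j ∑_k |ξ_k (w_j)| ^ r` is at most about `∑_j ‖w_j‖ ^ r`
(`exists_local_factorization`).

*Convexity.* The vectors that dominate `(∑_k |ξ_k (x_j)| ^ r)_j` for some such factorization form a
convex set. If it missed the orthant `v_j < ‖x_j‖ ^ r + ε`, a separating functional would
have nonnegative coefficients `λ_j`, and the local part for the points `λ_j ^ (1 / r) x_j` would give a
contradiction. Hence `∑_k |ξ_k (x)| ^ r ≤ ‖x‖ ^ r + ε` can be achieved for all `x` in a finite set
(`nonempty_approxFactorization`).

*Limit.* Along an ultrafilter on the finite subsets of `X`, these factorizations converge to a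
factorization of `T : X → Y**` through the ultraproduct of the spaces `ℓ_r^n`. That ultraproduct is
an `L_p` space, which is proved by an explicit representation. If `D` is the disjoint union of the
index sets, a function `f` on `D` whose `ℓ_r` norms on the fibres are bounded along the ultrafilter
defines by the Riesz theorem a measure `ν_f` on the Stone–Čech compactification of `D`, with
`∫ m dν_f = lim ∑ m |f| ^ r`. The function `g / f`, extended by continuity, is the density that
relates `ν_g` to `ν_f`, up to the part of `ν_g` which is singular to `ν_f`. Well-ordering all `f`,
keeping of each `ν_f` only the part that is singular to the earlier measures, and taking the
disjoint sum gives a measure for which `g ↦ (g / f)_f` is an isometry with dense range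
(`exists_denseRange_ultraLp`). As no countability is available here, regularity of the measures
takes the place of countable additivity (`sum_restrict_sdiff_iUnion_lt`).
-/

open Filter Topology
open scoped CompactlySupported

namespace BanachOp

noncomputable section

/-! ### Limits of finite sums along an ultrafilter -/

section UltraSum

variable {ι : Type u} {n : ι → ℕ} (U : Ultrafilter ι)

/-- The finite sums `∑ k, |a (i, k)|` stay bounded along `U`. -/
def UltraBounded (a : (Σ i, Fin (n i)) → ℝ) : Prop :=
  ∃ C, ∀ᶠ i in U, ∑ k, |a ⟨i, k⟩| ≤ C

/-- The limit along `U` of the finite sums `∑ k, a (i, k)`; meaningful for `UltraBounded` families. -/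
def ultraSum (a : (Σ i, Fin (n i)) → ℝ) : ℝ :=
  limUnder (U : Filter ι) (fun i => ∑ k, a ⟨i, k⟩)

variable {U}

theorem _root_.Ultrafilter.exists_tendsto_of_eventually_norm_le {E : Type*} [NormedAddCommGroup E]
    [ProperSpace E] {g : ι → E} {C : ℝ} (h : ∀ᶠ i in U, ‖g i‖ ≤ C) :
    ∃ l, Tendsto g U (𝓝 l) := by
  obtain ⟨l, -, hl⟩ := (isCompact_closedBall (0 : E) C).ultrafilter_le_nhds (U.map g) (by
    rw [le_principal_iff]
    exact h.mono fun i hi => by simpa using hi)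
  exact ⟨l, hl⟩

theorem UltraBounded.tendsto {a : (Σ i, Fin (n i)) → ℝ} (h : UltraBounded U a) :
    Tendsto (fun i => ∑ k, a ⟨i, k⟩) U (𝓝 (ultraSum U a)) := by
  obtain ⟨C, hC⟩ := h
  exact tendsto_nhds_limUnder (U.exists_tendsto_of_eventually_norm_le (C := C)
    (hC.mono fun i hi => (Finset.abs_sum_le_sum_abs _ _).trans hi))

theorem UltraBounded.mono {a b : (Σ i, Fin (n i)) → ℝ} (h : UltraBounded U b)
    (hab : ∀ d, |a d| ≤ |b d|) : UltraBounded U a := by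
  obtain ⟨C, hC⟩ := h
  exact ⟨C, hC.mono fun i hi => (Finset.sum_le_sum fun k _ => hab _).trans hi⟩

theorem UltraBounded.add {a b : (Σ i, Fin (n i)) → ℝ} (ha : UltraBounded U a)
    (hb : UltraBounded U b) : UltraBounded U (fun d => a d + b d) := by
  obtain ⟨C, hC⟩ := ha
  obtain ⟨C', hC'⟩ := hb
  refine ⟨C + C', ?_⟩
  filter_upwards [hC, hC'] with i h1 h2
  refine (Finset.sum_le_sum fun k _ => abs_add_le _ _).trans ?_
  rw [Finset.sum_add_distrib]
  exact add_le_add h1 h2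

theorem UltraBounded.const_mul {a : (Σ i, Fin (n i)) → ℝ} (ha : UltraBounded U a) (c : ℝ) :
    UltraBounded U (fun d => c * a d) := by
  obtain ⟨C, hC⟩ := ha
  refine ⟨|c| * C, hC.mono fun i h => ?_⟩
  simp only [abs_mul, ← Finset.mul_sum]
  gcongr

theorem UltraBounded.bounded_mul {a : (Σ i, Fin (n i)) → ℝ} (ha : UltraBounded U a)
    {m : (Σ i, Fin (n i)) → ℝ} {M : ℝ} (hm : ∀ d, |m d| ≤ M) :
    UltraBounded U (fun d => m d * a d) :=
  (ha.const_mul M).mono fun d => by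
    rw [abs_mul, abs_mul]
    exact mul_le_mul_of_nonneg_right ((hm d).trans (le_abs_self M)) (abs_nonneg _)

theorem ultraSum_add {a b : (Σ i, Fin (n i)) → ℝ} (ha : UltraBounded U a)
    (hb : UltraBounded U b) :
    ultraSum U (fun d => a d + b d) = ultraSum U a + ultraSum U b := by
  refine tendsto_nhds_unique (ha.add hb).tendsto ?_
  simpa only [Finset.sum_add_distrib] using ha.tendsto.add hb.tendsto

theorem ultraSum_const_mul {a : (Σ i, Fin (n i)) → ℝ} (ha : UltraBounded U a) (c : ℝ) :
    ultraSum U (fun d => c * a d) = c * ultraSum U a := by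
  refine tendsto_nhds_unique (ha.const_mul c).tendsto ?_
  simpa only [← Finset.mul_sum] using ha.tendsto.const_mul c

theorem ultraSum_nonneg {a : (Σ i, Fin (n i)) → ℝ} (ha : UltraBounded U a) (h0 : ∀ d, 0 ≤ a d) :
    0 ≤ ultraSum U a :=
  ge_of_tendsto' ha.tendsto fun _ => Finset.sum_nonneg fun _ _ => h0 _

end UltraSum

/-! ### Measures on the space of ultrafilters -/

section UltraMeasure

/-- The Borel σ-algebra on the Stone–Čech compactification `Ultrafilter α` of a discrete set. -/
instance ultrafilterMeasurableSpace {α : Type*} : MeasurableSpace (Ultrafilter α) :=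
  borel _

instance ultrafilterBorelSpace {α : Type*} : BorelSpace (Ultrafilter α) := ⟨rfl⟩

theorem regular_withDensity_of_le {K : Type*} [TopologicalSpace K] [T2Space K] [MeasurableSpace K]
    [BorelSpace K] (ν : Measure K) [IsFiniteMeasure ν] [ν.Regular] {w : K → ℝ≥0∞} {M : ℝ≥0}
    (hM : ∀ k, w k ≤ M) : (ν.withDensity w).Regular := by
  have hle : ∀ s, MeasurableSet s → ν.withDensity w s ≤ M * ν s := fun s hs => by
    rw [withDensity_apply _ hs]
    calc ∫⁻ k in s, w k ∂ν ≤ ∫⁻ _ in s, M ∂ν := lintegral_mono hM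
      _ = M * ν s := by simp
  have : IsFiniteMeasure (ν.withDensity w) :=
    ⟨(hle _ .univ).trans_lt (ENNReal.mul_lt_top ENNReal.coe_lt_top (measure_lt_top _ _))⟩
  have : (ν.withDensity w).InnerRegularCompactLTTop := by
    refine ⟨fun A hA r hr => ?_⟩
    obtain ⟨ε, hε, hr'⟩ : ∃ ε > 0, r + ε < ν.withDensity w A := by
      obtain ⟨ε, hε, h⟩ := ENNReal.lt_iff_exists_add_pos_lt.1 hr
      exact ⟨ε, by simpa using hε, h⟩
    have hε' : ε / (M + 1) ≠ 0 := by
      simp [hε.ne', ENNReal.div_eq_zero_iff]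
    obtain ⟨C, hCA, hC, hlt⟩ := hA.1.exists_isCompact_sdiff_lt (measure_ne_top ν A) hε'
    refine ⟨C, hCA, hC, ?_⟩
    have h1 : ν.withDensity w (A \ C) ≤ ε := by
      refine (hle _ (hA.1.diff hC.measurableSet)).trans ?_
      calc (M : ℝ≥0∞) * ν (A \ C) ≤ (M + 1) * (ε / (M + 1)) := by gcongr; simp
        _ ≤ ε := ENNReal.mul_div_le
    have h2 : ν.withDensity w A ≤ ν.withDensity w C + ε := by
      rw [← measure_inter_add_sdiff A hC.measurableSet, Set.inter_eq_right.2 hCA]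
      gcongr
    by_contra! hcon
    exact absurd (h2.trans (add_le_add_left hcon ε)) (not_le.2 hr')
  infer_instance

/-- The Riesz–Markov–Kakutani theorem on a compact space. -/
theorem exists_measure_of_positive_linearMap {K : Type*} [TopologicalSpace K] [CompactSpace K]
    [T2Space K] [MeasurableSpace K] [BorelSpace K] (L : C(K, ℝ) →ₗ[ℝ] ℝ)
    (hL : ∀ m : C(K, ℝ), (∀ k, 0 ≤ m k) → 0 ≤ L m) :
    ∃ ν : Measure K, IsFiniteMeasure ν ∧ ν.Regular ∧ ∀ m : C(K, ℝ), ∫ k, m k ∂ν = L m := by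
  let Λ₀ : C_c(K, ℝ) →ₗ[ℝ] ℝ :=
    { toFun := fun m => L m.toContinuousMap
      map_add' := fun f g => L.map_add f.toContinuousMap g.toContinuousMap
      map_smul' := fun c f => L.map_smul c f.toContinuousMap }
  let Λ : C_c(K, ℝ) →ₚ[ℝ] ℝ := PositiveLinearMap.mk₀ Λ₀ fun f hf => hL _ hf
  refine ⟨RealRMK.rieszMeasure Λ, ⟨isCompact_univ.measure_lt_top⟩, inferInstance, fun m => ?_⟩
  exact RealRMK.integral_rieszMeasure Λ ⟨m, HasCompactSupport.of_compactSpace _⟩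

variable {ι : Type u} {n : ι → ℕ} (U : Ultrafilter ι)

variable {U} in
theorem UltraBounded.continuousMap_mul {a : (Σ i, Fin (n i)) → ℝ} (ha : UltraBounded U a)
    (m : C(Ultrafilter (Σ i, Fin (n i)), ℝ)) : UltraBounded U (fun d => m (pure d) * a d) :=
  ha.bounded_mul (M := ‖m‖) fun _ => m.norm_coe_le_norm _

variable {U} in
/-- The functional `m ↦ lim_U ∑ k, m (i, k) a (i, k)` on `C(βD)`, where `D` is the index set of
the weights `a` and `βD` is its space of ultrafilters. -/
def ultraFunctional {a : (Σ i, Fin (n i)) → ℝ} (ha : UltraBounded U a) :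
    C(Ultrafilter (Σ i, Fin (n i)), ℝ) →ₗ[ℝ] ℝ where
  toFun m := ultraSum U (fun d => m (pure d) * a d)
  map_add' f g := by
    simp only [ContinuousMap.add_apply, add_mul]
    exact ultraSum_add (ha.continuousMap_mul f) (ha.continuousMap_mul g)
  map_smul' c f := by
    simp only [ContinuousMap.smul_apply, smul_eq_mul, mul_assoc, RingHom.id_apply]
    exact ultraSum_const_mul (ha.continuousMap_mul f) c

theorem ultraFunctional_nonneg {a : (Σ i, Fin (n i)) → ℝ} (h0 : ∀ d, 0 ≤ a d)
    (ha : UltraBounded U a) (m : C(Ultrafilter (Σ i, Fin (n i)), ℝ)) (hm : ∀ k, 0 ≤ m k) :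
    0 ≤ ultraFunctional ha m := by
  have := ultraSum_nonneg (ha.continuousMap_mul m) fun d => mul_nonneg (hm (pure d)) (h0 d)
  exact this

theorem exists_ultraMeasure {a : (Σ i, Fin (n i)) → ℝ} (h0 : ∀ d, 0 ≤ a d)
    (ha : UltraBounded U a) :
    ∃ ν : Measure (Ultrafilter (Σ i, Fin (n i))), IsFiniteMeasure ν ∧ ν.Regular ∧
      ∀ m : C(Ultrafilter (Σ i, Fin (n i)), ℝ),
        ∫ k, m k ∂ν = ultraSum U (fun d => m (pure d) * a d) :=
  exists_measure_of_positive_linearMap (ultraFunctional ha) (ultraFunctional_nonneg U h0 ha)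

open Classical in
/-- The measure on the Stone–Čech compactification that represents the positive functional
`m ↦ lim_U ∑ k, m (i, k) a (i, k)`; it is `0` unless `a` is nonnegative and `UltraBounded`. -/
def ultraMeasure (a : (Σ i, Fin (n i)) → ℝ) : Measure (Ultrafilter (Σ i, Fin (n i))) :=
  if h : (∀ d, 0 ≤ a d) ∧ UltraBounded U a then (exists_ultraMeasure U h.1 h.2).choose else 0

instance (a : (Σ i, Fin (n i)) → ℝ) : IsFiniteMeasure (ultraMeasure U a) := by
  unfold ultraMeasure
  split_ifs with h
  · exact (exists_ultraMeasure U h.1 h.2).choose_spec.1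
  · infer_instance

instance (a : (Σ i, Fin (n i)) → ℝ) : (ultraMeasure U a).Regular := by
  unfold ultraMeasure
  split_ifs with h
  · exact (exists_ultraMeasure U h.1 h.2).choose_spec.2.1
  · infer_instance

variable {U}

theorem integral_ultraMeasure {a : (Σ i, Fin (n i)) → ℝ} (h0 : ∀ d, 0 ≤ a d) (ha : UltraBounded U a)
    (m : C(Ultrafilter (Σ i, Fin (n i)), ℝ)) :
    ∫ k, m k ∂(ultraMeasure U a) = ultraSum U (fun d => m (pure d) * a d) := by
  rw [ultraMeasure, dif_pos ⟨h0, ha⟩]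
  exact (exists_ultraMeasure U h0 ha).choose_spec.2.2 m

theorem ultraMeasure_univ {a : (Σ i, Fin (n i)) → ℝ} (h0 : ∀ d, 0 ≤ a d) (ha : UltraBounded U a) :
    ultraMeasure U a Set.univ = ENNReal.ofReal (ultraSum U a) := by
  have h := integral_ultraMeasure h0 ha 1
  simp only [ContinuousMap.one_apply, integral_const, smul_eq_mul, mul_one, one_mul] at h
  rw [← h, Measure.real, ENNReal.ofReal_toReal (measure_ne_top _ _)]

/-- Multiplying the weights by (the values of) a continuous function multiplies the measure by
that function. -/
theorem ultraMeasure_eq_withDensity {a b : (Σ i, Fin (n i)) → ℝ} (hb0 : ∀ d, 0 ≤ b d)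
    (hb : UltraBounded U b) (c : C(Ultrafilter (Σ i, Fin (n i)), ℝ≥0))
    (hab : ∀ d, a d = c (pure d) * b d) :
    ultraMeasure U a = (ultraMeasure U b).withDensity (fun k => c k) := by
  let c' : C(Ultrafilter (Σ i, Fin (n i)), ℝ) := ⟨fun k => c k, by fun_prop⟩
  have ha0 : ∀ d, 0 ≤ a d := fun d => by rw [hab]; exact mul_nonneg (c _).2 (hb0 d)
  have ha : UltraBounded U a := by
    rw [show a = fun d => c' (pure d) * b d from funext hab]
    exact hb.bounded_mul (M := ‖c'‖) fun d => c'.norm_coe_le_norm _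
  obtain ⟨M, hM⟩ : ∃ M : ℝ≥0, ∀ k, c k ≤ M :=
    ⟨⟨‖c'‖, norm_nonneg _⟩, fun k => NNReal.coe_le_coe.1
      ((le_abs_self _).trans (c'.norm_coe_le_norm k))⟩
  have := regular_withDensity_of_le (ultraMeasure U b) (w := fun k => (c k : ℝ≥0∞)) (M := M)
    fun k => by exact_mod_cast hM k
  refine Measure.ext_of_integral_eq_on_compactlySupported fun m => ?_
  rw [integral_withDensity_eq_integral_smul c.continuous.measurable]
  have h1 := integral_ultraMeasure ha0 ha m.toContinuousMap
  have h2 := integral_ultraMeasure hb0 hb (c' * m.toContinuousMap)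
  simp only [CompactlySupportedContinuousMap.coe_toContinuousMap, ContinuousMap.mul_apply] at h1 h2
  rw [h1]
  simp only [NNReal.smul_def, smul_eq_mul]
  refine Eq.trans ?_ h2.symm
  congr 1
  ext d
  rw [hab]
  simp only [c', ContinuousMap.coe_mk]
  ring

end UltraMeasure

/-! ### Decomposing a regular measure along a well-ordered open cover -/

section Decomposition

variable {K : Type*} [TopologicalSpace K] [MeasurableSpace K] [BorelSpace K]
  (ν : Measure K) [IsFiniteMeasure ν] [ν.Regular]

/-- A union of open sets, of any cardinality, that are null within a measurable set `N` is null
within `N`: this is where regularity replaces countable additivity. -/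
theorem measure_inter_iUnion_null_of_isOpen {ι : Type*} {N : Set K} (hN : MeasurableSet N)
    {V : ι → Set K} (hV : ∀ i, IsOpen (V i)) (h : ∀ i, ν (N ∩ V i) = 0) :
    ν (N ∩ ⋃ i, V i) = 0 := by
  have hm : MeasurableSet (N ∩ ⋃ i, V i) := hN.inter (isOpen_iUnion hV).measurableSet
  rw [hm.measure_eq_iSup_isCompact_of_ne_top (measure_ne_top _ _)]
  simp only [ENNReal.iSup_eq_zero]
  intro C hC hCc
  obtain ⟨t, ht⟩ := hCc.elim_finite_subcover V hV (hC.trans Set.inter_subset_right)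
  refine measure_mono_null (t := ⋃ i ∈ t, N ∩ V i) (fun k hk => ?_)
    ((measure_biUnion_null_iff t.countable_toSet).2 fun i _ => h i)
  obtain ⟨i, hi, hki⟩ := Set.mem_iUnion₂.1 (ht hk)
  exact Set.mem_iUnion₂.2 ⟨i, hi, (hC hk).1, hki⟩

/-- A regular measure is the sum of its parts on the pieces `V i \ ⋃ j < i, V j` of a well-ordered
open cover, of any cardinality, of almost all of the space. -/
theorem sum_restrict_sdiff_iUnion_lt [T2Space K] {ι : Type*} [LinearOrder ι] [WellFoundedLT ι]
    {V : ι → Set K} (hV : ∀ i, IsOpen (V i)) (hfull : ν (⋃ i, V i)ᶜ = 0) :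
    Measure.sum (fun i => ν.restrict (V i \ ⋃ j : Set.Iio i, V j)) = ν := by
  set G : ι → Set K := fun i => V i \ ⋃ j : Set.Iio i, V j with hG
  have hGm : ∀ i, MeasurableSet (G i) := fun i =>
    (hV i).measurableSet.diff (isOpen_iUnion fun j => hV _).measurableSet
  have hdisj : Pairwise (Function.onFun Disjoint G) := by
    have key : ∀ i j, i < j → Disjoint (G i) (G j) := fun i j hij =>
      Set.disjoint_left.2 fun k hk hk' => hk'.2 (Set.mem_iUnion.2 ⟨⟨i, hij⟩, hk.1⟩)
    intro i j hij
    rcases lt_or_gt_of_ne hij with h | h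
    exacts [key i j h, (key j i h).symm]
  set c : Set ι := {i | 0 < ν (G i)}
  have hc : c.Countable := Measure.countable_meas_pos_of_disjoint_iUnion hGm hdisj
  set N : Set K := (⋃ i ∈ c, G i)ᶜ
  have hNm : MeasurableSet N := (MeasurableSet.biUnion hc fun i _ => hGm i).compl
  have hNV : ∀ i, ν (N ∩ V i) = 0 := fun i => by
    induction i using WellFoundedLT.induction with
    | ind i ih =>
      have h1 := measure_inter_iUnion_null_of_isOpen ν hNm (V := fun j : Set.Iio i => V j)
        (fun j => hV _) fun j => ih j j.2
      have h2 : ν (N ∩ G i) = 0 := by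
        by_cases hi : i ∈ c
        · rw [show N ∩ G i = ∅ from Set.eq_empty_of_forall_notMem fun k hk =>
            hk.1 (Set.mem_iUnion₂.2 ⟨i, hi, hk.2⟩), measure_empty]
        · exact measure_mono_null Set.inter_subset_right (by simpa [c] using hi)
      refine measure_mono_null (t := (N ∩ ⋃ j : Set.Iio i, V j) ∪ (N ∩ G i)) (fun k hk => ?_)
        (measure_union_null h1 h2)
      by_cases hk' : k ∈ ⋃ j : Set.Iio i, V j
      exacts [Or.inl ⟨hk.1, hk'⟩, Or.inr ⟨hk.1, hk.2, hk'⟩]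
  have hN : ν N = 0 := by
    refine measure_mono_null (t := (N ∩ ⋃ i, V i) ∪ (⋃ i, V i)ᶜ) (fun k hk => ?_)
      (measure_union_null (measure_inter_iUnion_null_of_isOpen ν hNm hV hNV) hfull)
    by_cases hk' : k ∈ ⋃ i, V i
    exacts [Or.inl ⟨hk, hk'⟩, Or.inr hk']
  ext E hE
  rw [Measure.sum_apply _ hE]
  simp only [Measure.restrict_apply hE]
  have hsupp : Function.support (fun i => ν (E ∩ G i)) ⊆ c := fun i hi =>
    (pos_iff_ne_zero.2 hi).trans_le (measure_mono Set.inter_subset_right)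
  rw [← tsum_subtype_eq_of_support_subset hsupp]
  have := hc.to_subtype
  rw [← measure_iUnion (f := fun i : c => E ∩ G i)
    (fun i j hij => ((hdisj (Subtype.coe_injective.ne hij)).mono Set.inter_subset_right
      Set.inter_subset_right)) fun i => hE.inter (hGm _)]
  refine le_antisymm (measure_mono (Set.iUnion_subset fun i => Set.inter_subset_left)) ?_
  rw [← add_zero (ν (⋃ i : c, E ∩ G i)), ← hN]
  refine (measure_mono fun k hk => ?_).trans (measure_union_le _ _)
  by_cases hk' : k ∈ N
  · exact Or.inr hk'
  · obtain ⟨i, hi, hki⟩ := Set.mem_iUnion₂.1 (not_not.1 hk')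
    exact Or.inl (Set.mem_iUnion.2 ⟨⟨i, hi⟩, hk, hki⟩)

end Decomposition

/-! ### Quotients of functions on a set, as continuous functions on its ultrafilters -/

section Quotients

variable {𝕜 : Type} [RCLike 𝕜] {D : Type u}

open Classical in
/-- The continuous function on the space of ultrafilters of `D` that extends `g / h` from `D`,
for functions with `‖g‖ ≤ h`; points where this inequality fails are given the value `0`. -/
def ultraQuot (g : D → 𝕜) (h : D → ℝ) : C(Ultrafilter D, 𝕜) where
  toFun k := (Ultrafilter.extend (γ := Metric.closedBall (0 : 𝕜) 1)
    (fun d => if hd : ‖g d / (h d : 𝕜)‖ ≤ 1 then ⟨g d / (h d : 𝕜), by simpa using hd⟩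
      else ⟨0, by simp⟩) k).1
  continuous_toFun := continuous_subtype_val.comp (continuous_ultrafilter_extend _)

theorem ultraQuot_pure {g : D → 𝕜} {h : D → ℝ} {d : D} (hg : ‖g d‖ ≤ h d) :
    ultraQuot g h (pure d) = g d / (h d : 𝕜) := by
  have h1 : ‖g d / (h d : 𝕜)‖ ≤ 1 := by
    rw [norm_div, RCLike.norm_ofReal]
    exact div_le_one_of_le₀ (hg.trans (le_abs_self _)) (abs_nonneg _)
  simp only [ultraQuot, ContinuousMap.coe_mk, ultrafilter_extend_pure, dif_pos h1]

theorem ultraQuot_pure_mul {g : D → 𝕜} {h : D → ℝ} {d : D} (hg : ‖g d‖ ≤ h d) :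
    ultraQuot g h (pure d) * (h d : 𝕜) = g d := by
  rw [ultraQuot_pure hg]
  rcases eq_or_ne (h d) 0 with h0 | h0
  · have : g d = 0 := norm_le_zero_iff.1 (hg.trans h0.le)
    simp [this]
  · exact div_mul_cancel₀ _ (by exact_mod_cast h0)

theorem norm_ultraQuot_pure_mul {g : D → 𝕜} {h : D → ℝ} {d : D} (hg : ‖g d‖ ≤ h d) :
    ‖ultraQuot g h (pure d)‖ * h d = ‖g d‖ := by
  conv_rhs => rw [← ultraQuot_pure_mul hg]
  rw [norm_mul, RCLike.norm_ofReal, abs_of_nonneg ((norm_nonneg _).trans hg)]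

theorem ultra_ext {E : Type*} [TopologicalSpace E] [T2Space E] {a b : Ultrafilter D → E}
    (ha : Continuous a) (hb : Continuous b) (h : ∀ d, a (pure d) = b (pure d)) (k : Ultrafilter D) :
    a k = b k :=
  congr_fun (denseRange_pure.equalizer ha hb (funext h)) k

theorem ultraQuot_add {f g : D → 𝕜} {h : D → ℝ} (hf : ∀ d, ‖f d‖ ≤ h d) (hg : ∀ d, ‖g d‖ ≤ h d)
    (hfg : ∀ d, ‖f d + g d‖ ≤ h d) (k : Ultrafilter D) :
    ultraQuot (fun d => f d + g d) h k = ultraQuot f h k + ultraQuot g h k := by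
  refine ultra_ext (b := fun k => ultraQuot f h k + ultraQuot g h k) (by fun_prop) (by fun_prop)
    (fun d => ?_) k
  rw [ultraQuot_pure (hf d), ultraQuot_pure (hg d), ultraQuot_pure (hfg d), add_div]

theorem ultraQuot_mul {g : D → 𝕜} {h : D → ℝ} (m : C(Ultrafilter D, 𝕜)) (hg : ∀ d, ‖g d‖ ≤ h d)
    (hmg : ∀ d, ‖m (pure d) * g d‖ ≤ h d) (k : Ultrafilter D) :
    ultraQuot (fun d => m (pure d) * g d) h k = m k * ultraQuot g h k := by
  refine ultra_ext (b := fun k => m k * ultraQuot g h k) (by fun_prop) (by fun_prop)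
    (fun d => ?_) k
  rw [ultraQuot_pure (hg d), ultraQuot_pure (hmg d), mul_div_assoc]

/-- The continuous extension of `g / (‖f‖ + ‖g‖)`. -/
def relQuot (g f : D → 𝕜) : C(Ultrafilter D, 𝕜) :=
  ultraQuot g (fun d => ‖f d‖ + ‖g d‖)

/-- The "value" of the quotient `g / f` at an ultrafilter, which is `0` where it is infinite. -/
def germQuot (g f : D → 𝕜) (k : Ultrafilter D) : 𝕜 :=
  relQuot g f k / relQuot f g k

theorem measurable_germQuot (g f : D → 𝕜) : Measurable (germQuot g f) :=
  (relQuot g f).continuous.measurable.div (relQuot f g).continuous.measurable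

theorem relQuot_mul_add_norm {f g : D → 𝕜} {h : D → ℝ} (hf : ∀ d, ‖f d‖ ≤ h d)
    (hg : ∀ d, ‖g d‖ ≤ h d) (k : Ultrafilter D) :
    relQuot g f k * ((‖ultraQuot f h k‖ + ‖ultraQuot g h k‖ : ℝ) : 𝕜) = ultraQuot g h k := by
  refine ultra_ext (a := fun k => relQuot g f k *
    ((‖ultraQuot f h k‖ + ‖ultraQuot g h k‖ : ℝ) : 𝕜)) (by fun_prop) (by fun_prop) (fun d => ?_) k
  have h1 : ‖g d‖ ≤ ‖f d‖ + ‖g d‖ := by simp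
  have h0 : 0 ≤ h d := (norm_nonneg _).trans (hf d)
  simp only [relQuot]
  rw [ultraQuot_pure (hf d), ultraQuot_pure (hg d), norm_div, norm_div, RCLike.norm_ofReal,
    abs_of_nonneg h0, ← add_div, RCLike.ofReal_div, ← mul_div_assoc,
    ultraQuot_pure_mul (h := fun d => ‖f d‖ + ‖g d‖) h1]

theorem germQuot_eq_div {f g : D → 𝕜} {h : D → ℝ} (hf : ∀ d, ‖f d‖ ≤ h d)
    (hg : ∀ d, ‖g d‖ ≤ h d) {k : Ultrafilter D} (hk : ultraQuot f h k ≠ 0) :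
    germQuot g f k = ultraQuot g h k / ultraQuot f h k := by
  have h1 := relQuot_mul_add_norm hf hg k
  have h2 := relQuot_mul_add_norm hg hf k
  rw [add_comm] at h2
  have h3 : ((‖ultraQuot f h k‖ + ‖ultraQuot g h k‖ : ℝ) : 𝕜) ≠ 0 := by
    have : 0 < ‖ultraQuot f h k‖ := norm_pos_iff.2 hk
    have : ‖ultraQuot f h k‖ + ‖ultraQuot g h k‖ ≠ 0 := by positivity
    exact_mod_cast this
  rw [germQuot, ← mul_div_mul_right _ _ h3, h1, h2]

/-- `|a| / (|a| + |b|) * |b| / (|b| + |c|) ≤ |a| / (|a| + |c|)` at every ultrafilter; in particular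
"`a` is negligible with respect to `c`" passes to the two factors on the left. -/
theorem norm_relQuot_mul_le (a b c : D → 𝕜) (k : Ultrafilter D) :
    ‖relQuot a b k‖ * ‖relQuot b c k‖ ≤ ‖relQuot a c k‖ := by
  refine denseRange_pure.induction_on (p := fun k => ‖relQuot a b k‖ * ‖relQuot b c k‖ ≤
    ‖relQuot a c k‖) k (isClosed_le (by fun_prop) (by fun_prop)) fun d => ?_
  have key : ∀ f g : D → 𝕜, ‖relQuot f g (pure d)‖ = ‖f d‖ / (‖g d‖ + ‖f d‖) := fun f g => by
    rw [relQuot, ultraQuot_pure (by simp), norm_div, RCLike.norm_ofReal,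
      abs_of_nonneg (by positivity)]
  rw [key, key, key]
  have ha := norm_nonneg (a d)
  have hb := norm_nonneg (b d)
  have hc := norm_nonneg (c d)
  rcases ha.eq_or_lt with h | h
  · simp [← h]
  rcases hb.eq_or_lt with h' | h'
  · simp only [← h', zero_div, mul_zero]
    positivity
  rw [div_mul_div_comm, div_le_div_iff₀ (by positivity) (by positivity)]
  nlinarith [mul_nonneg ha hc, mul_nonneg hb hc, mul_nonneg ha ha, mul_nonneg hb hb,
    mul_nonneg ha (mul_nonneg ha hc), mul_nonneg ha (mul_nonneg hb hb)]

end Quotients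

/-! ### The ultraproduct seminorm and its measures -/

section UltraLp

variable {𝕜 : Type} [RCLike 𝕜] {ι : Type u} {n : ι → ℕ}

theorem UltraBounded.rpow_add {U : Ultrafilter ι} {r : ℝ} (hr : 0 ≤ r)
    {f g : (Σ i, Fin (n i)) → ℝ} (hf0 : ∀ d, 0 ≤ f d) (hg0 : ∀ d, 0 ≤ g d)
    (hf : UltraBounded U (fun d => f d ^ r)) (hg : UltraBounded U (fun d => g d ^ r)) :
    UltraBounded U (fun d => (f d + g d) ^ r) := by
  refine ((hf.add hg).const_mul (2 ^ r)).mono fun d => ?_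
  have h1 := hf0 d
  have h2 := hg0 d
  rw [abs_of_nonneg (by positivity), abs_of_nonneg (by positivity)]
  calc (f d + g d) ^ r ≤ (2 * max (f d) (g d)) ^ r := by
        gcongr
        rw [two_mul]
        exact add_le_add (le_max_left _ _) (le_max_right _ _)
    _ = 2 ^ r * max (f d) (g d) ^ r := Real.mul_rpow (by norm_num) (by positivity)
    _ ≤ _ := by
        gcongr
        rcases max_choice (f d) (g d) with h | h <;> rw [h]
        · linarith [Real.rpow_nonneg h2 r]
        · linarith [Real.rpow_nonneg h1 r]

variable (𝕜 n) in
/-- The functions on `Σ i, Fin (n i)` whose `ℓ_r`-norms over the fibres stay bounded along `U`: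
the space of which the ultraproduct of the spaces `ℓ_r^{n i}` is a quotient. -/
def ultraLp (U : Ultrafilter ι) {r : ℝ} (hr : 0 < r) : Submodule 𝕜 ((Σ i, Fin (n i)) → 𝕜) where
  carrier := {f | UltraBounded U (fun d => ‖f d‖ ^ r)}
  zero_mem' := ⟨0, by simp [Real.zero_rpow hr.ne']⟩
  add_mem' {f g} hf hg := by
    change UltraBounded U (fun d => ‖f d + g d‖ ^ r)
    refine (UltraBounded.rpow_add hr.le (fun d => norm_nonneg (f d)) (fun d => norm_nonneg (g d))
      hf hg).mono fun d => ?_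
    rw [abs_of_nonneg (by positivity), abs_of_nonneg (by positivity)]
    exact Real.rpow_le_rpow (norm_nonneg _) (norm_add_le _ _) hr.le
  smul_mem' c f hf := by
    change UltraBounded U (fun d => ‖(c • f) d‖ ^ r)
    refine (UltraBounded.const_mul (a := fun d => ‖f d‖ ^ r) hf (‖c‖ ^ r)).mono fun d => ?_
    rw [Pi.smul_apply, norm_smul, Real.mul_rpow (norm_nonneg _) (norm_nonneg _)]

variable {U : Ultrafilter ι} {r : ℝ} {hr : 0 < r}

theorem ultraBounded_of_mem (f : ultraLp 𝕜 n U hr) : UltraBounded U (fun d => ‖f.1 d‖ ^ r) :=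
  f.2

/-- The measure `ν` on ultrafilters with `∫ m dν = lim_U ∑ k, m (i, k) ‖f (i, k)‖ ^ r`. -/
def normMeasure (f : ultraLp 𝕜 n U hr) : Measure (Ultrafilter (Σ i, Fin (n i))) :=
  ultraMeasure U (fun d => ‖f.1 d‖ ^ r)

instance (f : ultraLp 𝕜 n U hr) : IsFiniteMeasure (normMeasure f) := by
  unfold normMeasure
  infer_instance

instance (f : ultraLp 𝕜 n U hr) : (normMeasure f).Regular := by
  unfold normMeasure
  infer_instance

theorem normMeasure_univ (f : ultraLp 𝕜 n U hr) :
    normMeasure f Set.univ = ENNReal.ofReal (ultraSum U (fun d => ‖f.1 d‖ ^ r)) :=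
  ultraMeasure_univ (fun _ => by positivity) f.2

theorem normMeasure_eq_withDensity (f : ultraLp 𝕜 n U hr) {h : (Σ i, Fin (n i)) → ℝ}
    (hh : UltraBounded U (fun d => h d ^ r)) (hf : ∀ d, ‖f.1 d‖ ≤ h d) :
    normMeasure f = (ultraMeasure U (fun d => h d ^ r)).withDensity
      (fun k => ‖ultraQuot f.1 h k‖ₑ ^ r) := by
  have h0 : ∀ d, 0 ≤ h d := fun d => (norm_nonneg _).trans (hf d)
  have := ultraMeasure_eq_withDensity (a := fun d => ‖f.1 d‖ ^ r)
    (fun d => Real.rpow_nonneg (h0 d) r) hh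
    ⟨fun k => ‖ultraQuot f.1 h k‖₊ ^ r, (NNReal.continuous_rpow_const hr.le).comp
      (ultraQuot f.1 h).continuous.nnnorm⟩ fun d => by
        rw [← norm_ultraQuot_pure_mul (hf d), Real.mul_rpow (norm_nonneg _) (h0 d)]
        rfl
  rw [normMeasure, this]
  congr 1
  ext k
  simp [ENNReal.coe_rpow_of_nonneg _ hr.le, enorm_eq_nnnorm]

theorem ae_ultraQuot_ne_zero (f : ultraLp 𝕜 n U hr) {h : (Σ i, Fin (n i)) → ℝ}
    (hh : UltraBounded U (fun d => h d ^ r)) (hf : ∀ d, ‖f.1 d‖ ≤ h d) :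
    ∀ᵐ k ∂(normMeasure f), ultraQuot f.1 h k ≠ 0 := by
  have hm : Measurable (fun k => ‖ultraQuot f.1 h k‖ₑ ^ r) :=
    (ultraQuot f.1 h).continuous.measurable.enorm.pow_const r
  rw [normMeasure_eq_withDensity f hh hf, ae_withDensity_iff hm]
  refine ae_of_all _ fun k hk h0 => hk ?_
  rw [h0, enorm_zero, ENNReal.zero_rpow_of_pos hr]

theorem UltraBounded.norm_add_norm (f g : ultraLp 𝕜 n U hr) :
    UltraBounded U (fun d => (‖f.1 d‖ + ‖g.1 d‖) ^ r) :=
  UltraBounded.rpow_add hr.le (fun _ => norm_nonneg _) (fun _ => norm_nonneg _) f.2 g.2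

theorem ae_relQuot_ne_zero (f g : ultraLp 𝕜 n U hr) :
    ∀ᵐ k ∂(normMeasure f), relQuot f.1 g.1 k ≠ 0 :=
  ae_ultraQuot_ne_zero f (UltraBounded.norm_add_norm g f) fun d => by simp

/-- Passing from the measure of `f` to that of `g`: the density is `‖g / f‖ ^ r`, and the part of
the measure of `g` where `f` is negligible with respect to `g` is lost. -/
theorem normMeasure_withDensity_germQuot (f g : ultraLp 𝕜 n U hr) :
    (normMeasure f).withDensity (fun k => ‖germQuot g.1 f.1 k‖ₑ ^ r) =
      (normMeasure g).restrict {k | relQuot f.1 g.1 k ≠ 0} := by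
  set h : (Σ i, Fin (n i)) → ℝ := fun d => ‖f.1 d‖ + ‖g.1 d‖ with hh
  have hb : UltraBounded U (fun d => h d ^ r) := UltraBounded.norm_add_norm f g
  have hfq : relQuot f.1 g.1 = ultraQuot f.1 h := by
    rw [relQuot, hh]
    simp only [add_comm]
  have hgq : relQuot g.1 f.1 = ultraQuot g.1 h := rfl
  have hmf : Measurable (fun k => ‖ultraQuot f.1 h k‖ₑ ^ r) :=
    (ultraQuot f.1 h).continuous.measurable.enorm.pow_const r
  have hs : MeasurableSet {k | ultraQuot f.1 h k ≠ 0} :=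
    (isOpen_ne_fun (ultraQuot f.1 h).continuous continuous_const).measurableSet
  rw [normMeasure_eq_withDensity f hb fun d => by simp [hh],
    normMeasure_eq_withDensity g hb fun d => by simp [hh], hfq,
    ← withDensity_mul _ hmf ((measurable_germQuot _ _).enorm.pow_const r),
    restrict_withDensity hs, ← withDensity_indicator hs]
  congr 1
  ext k
  simp only [Pi.mul_apply, germQuot, hfq, hgq, Set.indicator_apply, Set.mem_ofPred_eq]
  split_ifs with hk
  · rw [← ENNReal.mul_rpow_of_nonneg _ _ hr.le, ← enorm_mul, mul_div_cancel₀ _ hk]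
  · rw [not_not.1 hk, enorm_zero, ENNReal.zero_rpow_of_pos hr, zero_mul]

theorem ae_germQuot_add (f g₁ g₂ : ultraLp 𝕜 n U hr) :
    ∀ᵐ k ∂(normMeasure f), germQuot (g₁ + g₂).1 f.1 k =
      germQuot g₁.1 f.1 k + germQuot g₂.1 f.1 k := by
  set h : (Σ i, Fin (n i)) → ℝ := fun d => ‖f.1 d‖ + (‖g₁.1 d‖ + ‖g₂.1 d‖) with hh
  have hb : UltraBounded U (fun d => h d ^ r) :=
    UltraBounded.rpow_add hr.le (fun _ => norm_nonneg _) (fun _ => by positivity) f.2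
      (UltraBounded.norm_add_norm g₁ g₂)
  have hf : ∀ d, ‖f.1 d‖ ≤ h d := fun d => by
    simp only [hh]
    linarith [norm_nonneg (g₁.1 d), norm_nonneg (g₂.1 d)]
  have h1 : ∀ d, ‖g₁.1 d‖ ≤ h d := fun d => by
    simp only [hh]
    linarith [norm_nonneg (f.1 d), norm_nonneg (g₂.1 d)]
  have h2 : ∀ d, ‖g₂.1 d‖ ≤ h d := fun d => by
    simp only [hh]
    linarith [norm_nonneg (f.1 d), norm_nonneg (g₁.1 d)]
  have h12 : ∀ d, ‖g₁.1 d + g₂.1 d‖ ≤ h d := fun d => (norm_add_le _ _).trans (by simp [hh])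
  filter_upwards [ae_ultraQuot_ne_zero f hb hf] with k hk
  rw [germQuot_eq_div hf h1 hk, germQuot_eq_div hf h2 hk,
    germQuot_eq_div hf (g := (g₁ + g₂).1) h12 hk, ← add_div]
  congr 1
  exact ultraQuot_add h1 h2 h12 k

variable (hr) in
/-- Multiplication of an element of `ultraLp` by a continuous function on ultrafilters. -/
def ultraMul (m : C(Ultrafilter (Σ i, Fin (n i)), 𝕜)) (g : ultraLp 𝕜 n U hr) :
    ultraLp 𝕜 n U hr :=
  ⟨fun d => m (pure d) * g.1 d, by
    change UltraBounded U (fun d => ‖m (pure d) * g.1 d‖ ^ r)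
    refine (UltraBounded.bounded_mul (a := fun d => ‖g.1 d‖ ^ r) g.2
      (m := fun d => ‖m (pure d)‖ ^ r) (M := ‖m‖ ^ r) fun d => ?_).mono fun d => ?_
    · rw [abs_of_nonneg (by positivity)]
      exact Real.rpow_le_rpow (norm_nonneg _) (m.norm_coe_le_norm _) hr.le
    · rw [norm_mul, Real.mul_rpow (norm_nonneg _) (norm_nonneg _)]⟩

theorem ae_germQuot_mul (f g : ultraLp 𝕜 n U hr) (m : C(Ultrafilter (Σ i, Fin (n i)), 𝕜)) :
    ∀ᵐ k ∂(normMeasure f), germQuot (ultraMul hr m g).1 f.1 k = m k * germQuot g.1 f.1 k := by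
  set h : (Σ i, Fin (n i)) → ℝ := fun d => ‖f.1 d‖ + (‖g.1 d‖ + ‖(ultraMul hr m g).1 d‖) with hh
  have hb : UltraBounded U (fun d => h d ^ r) :=
    UltraBounded.rpow_add hr.le (fun _ => norm_nonneg _) (fun _ => by positivity) f.2
      (UltraBounded.norm_add_norm g _)
  have hf : ∀ d, ‖f.1 d‖ ≤ h d := fun d => by
    simp only [hh]
    linarith [norm_nonneg (g.1 d), norm_nonneg ((ultraMul hr m g).1 d)]
  have h1 : ∀ d, ‖g.1 d‖ ≤ h d := fun d => by
    simp only [hh]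
    linarith [norm_nonneg (f.1 d), norm_nonneg ((ultraMul hr m g).1 d)]
  have h2 : ∀ d, ‖(ultraMul hr m g).1 d‖ ≤ h d := fun d => by
    simp only [hh]
    linarith [norm_nonneg (f.1 d), norm_nonneg (g.1 d)]
  filter_upwards [ae_ultraQuot_ne_zero f hb hf] with k hk
  rw [germQuot_eq_div hf h1 hk, germQuot_eq_div hf h2 hk, ← mul_div_assoc]
  congr 1
  exact ultraQuot_mul m h1 h2 k

end UltraLp

/-! ### The ultraproduct of finite-dimensional `ℓ_p` spaces inside an `L_p` space -/

section Sigma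

variable {J K : Type*} [MeasurableSpace K]

theorem measurableSet_sigma_iff {s : Set (Σ _ : J, K)} :
    MeasurableSet s ↔ ∀ j, MeasurableSet (Sigma.mk j ⁻¹' s) :=
  MeasurableSpace.measurableSet_iInf

theorem measurable_sigma_iff {E : Type*} [MeasurableSpace E] {F : (Σ _ : J, K) → E} :
    Measurable F ↔ ∀ j, Measurable fun k => F ⟨j, k⟩ :=
  ⟨fun h _ _ ht => measurableSet_sigma_iff.1 (h ht) _,
    fun h _ ht => measurableSet_sigma_iff.2 fun j => h j ht⟩

theorem measurable_sigmaMk (j : J) : Measurable (fun k : K => (⟨j, k⟩ : Σ _ : J, K)) :=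
  fun _ ht => measurableSet_sigma_iff.1 ht j

theorem measurableSet_image_sigmaMk (j : J) {E : Set K} (hE : MeasurableSet E) :
    MeasurableSet ((fun k : K => (⟨j, k⟩ : Σ _ : J, K)) '' E) := by
  refine measurableSet_sigma_iff.2 fun i => ?_
  rcases eq_or_ne i j with rfl | hij
  · rwa [Set.preimage_image_eq _ sigma_mk_injective]
  · convert MeasurableSet.empty
    refine Set.eq_empty_of_forall_notMem ?_
    rintro k ⟨k', -, h⟩
    exact hij (congrArg Sigma.fst h).symm

end Sigma

section Representation

variable {𝕜 : Type} [RCLike 𝕜] {ι : Type u} {n : ι → ℕ} {U : Ultrafilter ι} {r : ℝ} {hr : 0 < r}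

theorem ae_germQuot_smul (f g : ultraLp 𝕜 n U hr) (c : 𝕜) :
    ∀ᵐ k ∂(normMeasure f), germQuot (c • g).1 f.1 k = c * germQuot g.1 f.1 k :=
  ae_germQuot_mul f g (ContinuousMap.const _ c)

theorem ae_germQuot_self (f : ultraLp 𝕜 n U hr) :
    ∀ᵐ k ∂(normMeasure f), germQuot f.1 f.1 k = 1 := by
  filter_upwards [ae_relQuot_ne_zero f f] with k hk
  exact div_self hk

variable {J : Type u} [LinearOrder J] (e : J → ultraLp 𝕜 n U hr)

/-- The set where `e j` dominates all `e i` with `i < j`: it carries the part of the measure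
of `e j` that is disjoint from all the earlier ones. -/
def newPart (j : J) : Set (Ultrafilter (Σ i, Fin (n i))) :=
  {k | ∀ i : Set.Iio j, relQuot (e i).1 (e j).1 k = 0}

theorem measurableSet_newPart (j : J) : MeasurableSet (newPart e j) := by
  have : IsClosed (newPart e j) := by
    simp only [newPart, Set.ofPred_forall]
    exact isClosed_iInter fun i => isClosed_eq (relQuot _ _).continuous continuous_const
  exact this.measurableSet

/-- The disjoint sum over `j` of the measures of `e j` restricted to `newPart e j`. -/
def bandMeasure : Measure (Σ _ : J, Ultrafilter (Σ i, Fin (n i))) :=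
  Measure.sum fun j => ((normMeasure (e j)).restrict (newPart e j)).map (fun k => ⟨j, k⟩)

theorem lintegral_bandMeasure {F : (Σ _ : J, Ultrafilter (Σ i, Fin (n i))) → ℝ≥0∞}
    (hF : Measurable F) :
    ∫⁻ x, F x ∂(bandMeasure e) =
      ∑' j, ∫⁻ k in newPart e j, F ⟨j, k⟩ ∂(normMeasure (e j)) := by
  rw [bandMeasure, lintegral_sum_measure]
  exact tsum_congr fun j => lintegral_map hF (measurable_sigmaMk j)

theorem ae_bandMeasure {P : (Σ _ : J, Ultrafilter (Σ i, Fin (n i))) → Prop}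
    (hP : MeasurableSet {x | P x})
    (h : ∀ j, ∀ᵐ k ∂(normMeasure (e j)), k ∈ newPart e j → P ⟨j, k⟩) :
    ∀ᵐ x ∂(bandMeasure e), P x := by
  rw [bandMeasure, Measure.ae_sum_iff' hP]
  intro j
  rw [ae_map_iff (measurable_sigmaMk j).aemeasurable hP]
  exact (ae_restrict_iff' (measurableSet_newPart e j)).2 (h j)

/-- The measure of `g` is recovered from its parts with respect to all the `e j`. -/
theorem sum_newPart_withDensity_germQuot [WellFoundedLT J] {g : ultraLp 𝕜 n U hr}
    (hg : g ∈ Set.range e) :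
    Measure.sum (fun j => ((normMeasure (e j)).restrict (newPart e j)).withDensity
      (fun k => ‖germQuot g.1 (e j).1 k‖ₑ ^ r)) = normMeasure g := by
  set V : J → Set (Ultrafilter (Σ i, Fin (n i))) := fun j => {k | relQuot (e j).1 g.1 k ≠ 0}
  have hV : ∀ j, IsOpen (V j) := fun j => isOpen_ne_fun (relQuot _ _).continuous continuous_const
  have hfull : normMeasure g (⋃ j, V j)ᶜ = 0 := by
    obtain ⟨j, rfl⟩ := hg
    exact measure_mono_null (fun k hk h0 => hk (Set.mem_iUnion.2 ⟨j, h0⟩))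
      (ae_iff.1 (ae_relQuot_ne_zero (e j) (e j)))
  rw [← sum_restrict_sdiff_iUnion_lt (normMeasure g) hV hfull]
  congr 1
  ext1 j
  rw [← restrict_withDensity (measurableSet_newPart e j), normMeasure_withDensity_germQuot,
    Measure.restrict_restrict (measurableSet_newPart e j)]
  refine Measure.restrict_congr_set ?_
  filter_upwards [ae_relQuot_ne_zero g (e j)] with k hk
  refine propext ⟨fun ⟨h1, h2⟩ => ⟨h2, fun h3 => ?_⟩, fun ⟨h1, h2⟩ => ⟨fun i => ?_, h1⟩⟩
  · obtain ⟨i, hi⟩ := Set.mem_iUnion.1 h3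
    have := norm_relQuot_mul_le (e i).1 g.1 (e j).1 k
    rw [h1 i, norm_zero, ← norm_mul, norm_le_zero_iff] at this
    exact (mul_ne_zero hi hk) this
  · have := norm_relQuot_mul_le (e i).1 (e j).1 g.1 k
    have h3 : relQuot (e i).1 g.1 k = 0 := by
      by_contra h3
      exact h2 (Set.mem_iUnion.2 ⟨i, h3⟩)
    rw [h3, norm_zero, ← norm_mul, norm_le_zero_iff] at this
    exact (mul_eq_zero.1 this).resolve_right h1

/-- The function on the disjoint sum that represents `g`; on the summand `j` it is `g / e j`. -/
def germFun (g : ultraLp 𝕜 n U hr) (x : Σ _ : J, Ultrafilter (Σ i, Fin (n i))) : 𝕜 :=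
  germQuot g.1 (e x.1).1 x.2

omit [LinearOrder J] in
theorem measurable_germFun (g : ultraLp 𝕜 n U hr) : Measurable (germFun e g) :=
  measurable_sigma_iff.2 fun j => measurable_germQuot g.1 (e j).1

theorem lintegral_mul_germFun [WellFoundedLT J] {g : ultraLp 𝕜 n U hr} (hg : g ∈ Set.range e)
    {w : Ultrafilter (Σ i, Fin (n i)) → ℝ≥0∞} (hw : Measurable w) :
    ∫⁻ x, w x.2 * ‖germFun e g x‖ₑ ^ r ∂(bandMeasure e) = ∫⁻ k, w k ∂(normMeasure g) := by
  have hm : ∀ j, Measurable fun k => ‖germQuot g.1 (e j).1 k‖ₑ ^ r := fun j =>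
    (measurable_germQuot _ _).enorm.pow_const r
  rw [lintegral_bandMeasure e]
  · rw [← sum_newPart_withDensity_germQuot e hg, lintegral_sum_measure]
    refine tsum_congr fun j => ?_
    rw [lintegral_withDensity_eq_lintegral_mul _ (hm j) hw]
    refine lintegral_congr fun k => ?_
    rw [Pi.mul_apply, mul_comm]
    rfl
  · exact measurable_sigma_iff.2 fun j => hw.mul (hm j)

theorem lintegral_germFun [WellFoundedLT J] {g : ultraLp 𝕜 n U hr} (hg : g ∈ Set.range e) :
    ∫⁻ x, ‖germFun e g x‖ₑ ^ r ∂(bandMeasure e) =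
      ENNReal.ofReal (ultraSum U (fun d => ‖g.1 d‖ ^ r)) := by
  have := lintegral_mul_germFun e hg (w := fun _ => 1) measurable_const
  simpa [normMeasure_univ] using this

theorem ae_germFun_add (g₁ g₂ : ultraLp 𝕜 n U hr) :
    germFun e (g₁ + g₂) =ᵐ[bandMeasure e] germFun e g₁ + germFun e g₂ := by
  refine ae_bandMeasure e (measurableSet_eq_fun (measurable_germFun e _)
    ((measurable_germFun e _).add (measurable_germFun e _))) fun j => ?_
  filter_upwards [ae_germQuot_add (e j) g₁ g₂] with k hk _ using hk

theorem ae_germFun_smul (c : 𝕜) (g : ultraLp 𝕜 n U hr) :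
    germFun e (c • g) =ᵐ[bandMeasure e] c • germFun e g := by
  refine ae_bandMeasure e (measurableSet_eq_fun (measurable_germFun e _)
    ((measurable_germFun e _).const_smul c)) fun j => ?_
  filter_upwards [ae_germQuot_smul (e j) g c] with k hk _ using hk

/-- On the summand `i ≠ j`, the function `e j / e i` vanishes on the part belonging to `e j`:
so multiplying the function of `e j` by an indicator localizes it to the summand `j`. -/
theorem ae_indicator_mul_germFun (j : J) {E : Set (Ultrafilter (Σ i, Fin (n i)))}
    (hE : MeasurableSet E) (c : 𝕜) :
    (fun x => (E ∩ newPart e j).indicator (fun _ => c) x.2 * germFun e (e j) x)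
      =ᵐ[bandMeasure e]
        ((fun k => (⟨j, k⟩ : Σ _ : J, Ultrafilter (Σ i, Fin (n i)))) '' E).indicator (fun _ => c) := by
  have hEm := measurableSet_image_sigmaMk j hE
  refine ae_bandMeasure e (measurableSet_eq_fun ?_ (measurable_const.indicator hEm)) fun i => ?_
  · refine Measurable.mul (measurable_sigma_iff.2 fun i => ?_) (measurable_germFun e _)
    exact measurable_const.indicator (hE.inter (measurableSet_newPart e j))
  rcases eq_or_ne i j with rfl | hij
  · filter_upwards [ae_germQuot_self (e i)] with k hk hki
    change (E ∩ newPart e i).indicator (fun _ => c) k * germQuot (e i).1 (e i).1 k = _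
    rw [hk, mul_one]
    by_cases hkE : k ∈ E
    · rw [Set.indicator_of_mem (s := E ∩ newPart e i) ⟨hkE, hki⟩, Set.indicator_of_mem (Set.mem_image_of_mem _ hkE)]
    · rw [Set.indicator_of_notMem fun h => hkE h.1, Set.indicator_of_notMem]
      rintro ⟨k', hk', h⟩
      exact hkE (sigma_mk_injective h ▸ hk')
  · refine ae_of_all _ fun k hki => ?_
    rw [Set.indicator_of_notMem]
    · change (E ∩ newPart e j).indicator (fun _ => c) k * (relQuot (e j).1 (e i).1 k /
        relQuot (e i).1 (e j).1 k) = 0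
      by_cases hk : k ∈ E ∩ newPart e j
      · rcases lt_or_gt_of_ne hij with h | h
        · rw [hk.2 ⟨i, h⟩, div_zero, mul_zero]
        · rw [hki ⟨j, h⟩, zero_div, mul_zero]
      · rw [Set.indicator_of_notMem hk, zero_mul]
    · rintro ⟨k', -, h⟩
      exact hij (congrArg Sigma.fst h).symm

end Representation

section LpRepresentation

variable {𝕜 : Type} [RCLike 𝕜] {ι : Type u} {n : ι → ℕ} {U : Ultrafilter ι}
  {p : ℝ≥0∞} {hr : 0 < p.toReal}
  {J : Type u} [LinearOrder J] [WellFoundedLT J] (e : J → ultraLp 𝕜 n U hr)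

theorem memLp_germFun {g : ultraLp 𝕜 n U hr} (hg : g ∈ Set.range e) :
    MemLp (germFun e g) p (bandMeasure e) := by
  have h := ENNReal.toReal_pos_iff.1 hr
  refine ⟨(measurable_germFun e g).aestronglyMeasurable, ?_⟩
  rw [eLpNorm_lt_top_iff_lintegral_rpow_enorm_lt_top h.1.ne' h.2.ne, lintegral_germFun e hg]
  exact ENNReal.ofReal_lt_top

variable [Fact (1 ≤ p)]

/-- The linear map from `ultraLp` to an `L_p` space given by `germFun`. -/
def germLp (he : Function.Surjective e) : ultraLp 𝕜 n U hr →ₗ[𝕜] Lp 𝕜 p (bandMeasure e) where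
  toFun g := (memLp_germFun e (he g)).toLp
  map_add' f g := (MemLp.toLp_eq_toLp_iff _ ((memLp_germFun e (he f)).add
    (memLp_germFun e (he g)))).2 (ae_germFun_add e f g)
  map_smul' c g := (MemLp.toLp_eq_toLp_iff _ ((memLp_germFun e (he g)).const_smul c)).2
    (ae_germFun_smul e c g)

omit [Fact (1 ≤ p)] in
theorem norm_germLp_rpow (he : Function.Surjective e) (g : ultraLp 𝕜 n U hr) :
    ‖germLp e he g‖ ^ p.toReal = ultraSum U (fun d => ‖g.1 d‖ ^ p.toReal) := by
  have h := ENNReal.toReal_pos_iff.1 hr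
  have h0 : 0 ≤ ultraSum U (fun d => ‖g.1 d‖ ^ p.toReal) :=
    ultraSum_nonneg g.2 fun _ => by positivity
  change ‖(memLp_germFun e (he g)).toLp‖ ^ p.toReal = _
  rw [Lp.norm_toLp, eLpNorm_eq_lintegral_rpow_enorm_toReal h.1.ne' h.2.ne,
    lintegral_germFun e (he g), ← ENNReal.toReal_rpow, ENNReal.toReal_ofReal h0,
    ← Real.rpow_mul h0, one_div, inv_mul_cancel₀ hr.ne', Real.rpow_one]

theorem indicator_image_mem_closure_range_germLp (he : Function.Surjective e) (j : J)
    {E : Set (Ultrafilter (Σ i, Fin (n i)))} (hE : MeasurableSet E) (c : 𝕜)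
    (hμ : bandMeasure e ((fun k => ⟨j, k⟩) '' E) ≠ ∞) :
    indicatorConstLp p (measurableSet_image_sigmaMk j hE) hμ c ∈
      (LinearMap.range (germLp e he)).topologicalClosure := by
  have hp := ENNReal.toReal_pos_iff.1 hr
  rw [← SetLike.mem_coe, Submodule.topologicalClosure_coe, Metric.mem_closure_iff]
  intro ε hε
  have hEm := hE.inter (measurableSet_newPart e j)
  obtain ⟨m, hm, -⟩ := (memLp_indicator_const p hEm c (Or.inr (measure_ne_top
    (normMeasure (e j)) _))).exists_boundedContinuous_eLpNorm_sub_le hp.2.ne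
    (ε := ENNReal.ofReal (ε / 2)) (by simpa using hε)
  refine ⟨germLp e he (ultraMul hr m.toContinuousMap (e j)), ⟨_, rfl⟩, ?_⟩
  have hM := memLp_germFun e (he (ultraMul hr m.toContinuousMap (e j)))
  have hI := memLp_indicator_const (μ := bandMeasure e) p (measurableSet_image_sigmaMk j hE) c
    (Or.inr hμ)
  rw [dist_eq_norm]
  change ‖hI.toLp _ - hM.toLp _‖ < ε
  rw [← MemLp.toLp_sub, Lp.norm_toLp]
  refine lt_of_le_of_lt (ENNReal.toReal_mono ENNReal.ofReal_ne_top (b := ENNReal.ofReal (ε / 2)) ?_)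
    (by rw [ENNReal.toReal_ofReal (by positivity)]; linarith)
  refine le_trans (le_of_eq ?_) hm
  have hmul : germFun e (ultraMul hr m.toContinuousMap (e j)) =ᵐ[bandMeasure e]
      fun x => m x.2 * germFun e (e j) x := by
    refine ae_bandMeasure e (measurableSet_eq_fun (measurable_germFun e _)
      (Measurable.mul (measurable_sigma_iff.2 fun _ => m.continuous.measurable)
        (measurable_germFun e _))) fun i => ?_
    filter_upwards [ae_germQuot_mul (e i) (e j) m.toContinuousMap] with k hk _ using hk
  rw [eLpNorm_eq_lintegral_rpow_enorm_toReal hp.1.ne' hp.2.ne,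
    eLpNorm_eq_lintegral_rpow_enorm_toReal hp.1.ne' hp.2.ne]
  congr 1
  rw [← lintegral_mul_germFun e (he (e j))]
  · refine lintegral_congr_ae ?_
    filter_upwards [hmul, ae_indicator_mul_germFun e j hE c] with x h1 h2
    rw [Pi.sub_apply, h1, ← h2, ← sub_mul, enorm_mul, ENNReal.mul_rpow_of_nonneg _ _ hr.le]
    rfl
  · exact (((measurable_const.indicator hEm).sub m.continuous.measurable).enorm.pow_const _)

theorem denseRange_germLp (he : Function.Surjective e) : DenseRange (germLp e he) := by
  have hp := ENNReal.toReal_pos_iff.1 hr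
  set V := (LinearMap.range (germLp e he)).topologicalClosure
  have hV : IsClosed (V : Set (Lp 𝕜 p (bandMeasure e))) := Submodule.isClosed_topologicalClosure _
  suffices h : ∀ f : Lp 𝕜 p (bandMeasure e), f ∈ V by
    intro f
    simpa [V] using! h f
  intro f
  refine Lp.induction hp.2.ne (motive := fun f => f ∈ V) (fun c {s} hs hμs => ?_)
    (fun {f g} hf hg _ h1 h2 => V.add_mem h1 h2) hV f
  rw [Lp.simpleFunc.coe_indicatorConst]
  -- the part of `s` that lies in finitely many summands
  set A : Finset J → Set (Σ _ : J, Ultrafilter (Σ i, Fin (n i))) := fun t => s ∩ {x | x.1 ∈ t}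
  have hT : ∀ t : Finset J, MeasurableSet
      {x : Σ _ : J, Ultrafilter (Σ i, Fin (n i)) | x.1 ∈ t} := fun t =>
    measurableSet_sigma_iff.2 fun j => MeasurableSet.const (j ∈ t)
  have hA : ∀ t, MeasurableSet (A t) := fun t => hs.inter (hT t)
  have hAμ : ∀ t, bandMeasure e (A t) ≠ ∞ := fun t =>
    ((measure_mono Set.inter_subset_left).trans_lt hμs).ne
  have hmem : ∀ t, indicatorConstLp p (hA t) (hAμ t) c ∈ V := by
    intro t
    induction t using Finset.induction_on with
    | empty =>
      have h0 : A ∅ = ∅ := by simp [A]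
      have : indicatorConstLp p (hA ∅) (hAμ ∅) c = 0 := by
        simp only [h0, indicatorConstLp_empty]
      rw [this]
      exact V.zero_mem
    | insert j t hj ih =>
      set E : Set (Ultrafilter (Σ i, Fin (n i))) := (fun k => ⟨j, k⟩) ⁻¹' s
      have hE : MeasurableSet E := measurable_sigmaMk j hs
      have hsub : (fun k => (⟨j, k⟩ : Σ _ : J, Ultrafilter (Σ i, Fin (n i)))) '' E ⊆ s :=
        Set.image_preimage_subset _ _
      have hμE := ((measure_mono hsub).trans_lt hμs).ne
      have hdisj : Disjoint (A t)
          ((fun k => (⟨j, k⟩ : Σ _ : J, Ultrafilter (Σ i, Fin (n i)))) '' E) := by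
        rw [Set.disjoint_left]
        rintro _ hx ⟨k, -, rfl⟩
        exact hj hx.2
      have hunion : A (insert j t) = A t ∪
          ((fun k => (⟨j, k⟩ : Σ _ : J, Ultrafilter (Σ i, Fin (n i)))) '' E) := by
        ext ⟨i, k⟩
        refine ⟨fun ⟨h1, h2⟩ => ?_, ?_⟩
        · rcases Finset.mem_insert.1 h2 with h | h
          · obtain rfl : i = j := h
            exact Or.inr ⟨k, h1, rfl⟩
          · exact Or.inl ⟨h1, h⟩
        · rintro (⟨h1, h2⟩ | ⟨k', h1, h2⟩)
          · exact ⟨h1, Finset.mem_insert_of_mem h2⟩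
          · rw [← h2]
            exact ⟨h1, Finset.mem_insert_self _ _⟩
      have : indicatorConstLp p (hA (insert j t)) (hAμ _) c = indicatorConstLp p (hA t) (hAμ t) c +
          indicatorConstLp p (measurableSet_image_sigmaMk j hE) hμE c := by
        rw [← indicatorConstLp_disjoint_union (hA t) (measurableSet_image_sigmaMk j hE) (hAμ t) hμE
          hdisj]
        simp only [hunion]
      rw [this]
      exact V.add_mem ih (indicator_image_mem_closure_range_germLp e he j hE c hμE)
  refine hV.mem_of_tendsto (f := fun t => indicatorConstLp p (hA t) (hAμ t) c) (b := atTop)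
    (tendsto_indicatorConstLp_set hp.2.ne ?_) (Eventually.of_forall hmem)
  have hsum : ∀ B, MeasurableSet B → bandMeasure e B =
      ∑' j, ((normMeasure (e j)).restrict (newPart e j)).map (fun k => ⟨j, k⟩) B := fun B hB => by
    rw [bandMeasure, Measure.sum_apply _ hB]
  have hlim := ENNReal.tendsto_tsum_compl_atTop_zero (((hsum s hs).symm.trans_lt hμs).ne)
  refine tendsto_of_tendsto_of_tendsto_of_le_of_le tendsto_const_nhds hlim (fun _ => zero_le)
    fun t => ?_
  have hdiff : symmDiff (A t) s = s ∩ {x | x.1 ∈ t}ᶜ := by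
    rw [Set.symmDiff_def, Set.sdiff_eq_empty.2 Set.inter_subset_left, Set.empty_union]
    exact Set.sdiff_self_inter
  rw [hdiff, hsum _ (hs.inter (hT t).compl), ← tsum_subtype_eq_of_support_subset
    (s := {j | j ∉ t})]
  · exact ENNReal.tsum_le_tsum fun j => measure_mono Set.inter_subset_left
  · intro j hj hjt
    refine hj ?_
    beta_reduce
    rw [Measure.map_apply (measurable_sigmaMk j) (hs.inter (hT t).compl)]
    exact measure_mono_null (t := ∅) (fun k hk => hk.2 hjt) measure_empty

/-- The ultraproduct of the spaces `ℓ_p^{n i}` embeds as a dense subspace of some `L_p`-space. -/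
theorem exists_denseRange_ultraLp (𝕜 : Type) [RCLike 𝕜] {ι : Type u} (n : ι → ℕ) (U : Ultrafilter ι)
    (p : ℝ≥0∞) [Fact (1 ≤ p)] (hr : 0 < p.toReal) :
    ∃ (Ω : Type u) (_ : MeasurableSpace Ω) (μ : Measure Ω) (R : ultraLp 𝕜 n U hr →ₗ[𝕜] Lp 𝕜 p μ),
      DenseRange R ∧ ∀ g, ‖R g‖ ^ p.toReal = ultraSum U (fun d => ‖g.1 d‖ ^ p.toReal) := by
  obtain ⟨_, _⟩ := exists_wellFoundedLT (ultraLp 𝕜 n U hr)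
  exact ⟨_, _, _, germLp id Function.surjective_id, denseRange_germLp _ _, norm_germLp_rpow _ _⟩

end LpRepresentation

/-! ### From finite-dimensional approximate factorizations to a factorization -/

section Limit

variable {𝕜 : Type} [RCLike 𝕜]
  {X Y : Type u} [NormedAddCommGroup X] [NormedSpace 𝕜 X] [NormedAddCommGroup Y] [NormedSpace 𝕜 Y]

/-- An approximate factorization `x ↦ ∑ k, ξ k x • y k` of `T` through `ℓ_r^n`: the lifting
`(y k)` has norm at most `c`; on the points of `s` the linear map `(ξ k)` has norm at most `1`
and the composition agrees with `T`, both up to the error `ε`. -/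
structure ApproxFactorization (T : X →L[𝕜] Y) (r c : ℝ) (s : Finset X) (ε : ℝ) where
  n : ℕ
  ξ : Fin n → X →ₗ[𝕜] 𝕜
  y : Fin n → Y
  norm_sum_smul_le : ∀ a : Fin n → 𝕜, ‖∑ k, a k • y k‖ ≤ c * (∑ k, ‖a k‖ ^ r) ^ (1 / r)
  sum_norm_le : ∀ x ∈ s, ∑ k, ‖ξ k x‖ ^ r ≤ ‖x‖ ^ r + ε
  norm_sub_le : ∀ x ∈ s, ‖∑ k, ξ k x • y k - T x‖ ≤ ε

variable {ι : Type u} {n : ι → ℕ} {U : Ultrafilter ι} {r : ℝ} {hr : 0 < r}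

/-- For vectors `y i k` such that the maps `a ↦ ∑ k, a k • y i k` on `ℓ_r^{n i}` are bounded by
`c`, the limit along `U` of these maps, with values in the bidual. -/
theorem exists_ultraLp_toBidual {c : ℝ} (y : ∀ i, Fin (n i) → Y)
    (hy : ∀ i (a : Fin (n i) → 𝕜), ‖∑ k, a k • y i k‖ ≤ c * (∑ k, ‖a k‖ ^ r) ^ (1 / r)) :
    ∃ b : ultraLp 𝕜 n U hr →ₗ[𝕜] StrongDual 𝕜 (StrongDual 𝕜 Y),
      (∀ f φ, Tendsto (fun i => φ (∑ k, f.1 ⟨i, k⟩ • y i k)) U (𝓝 (b f φ))) ∧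
      ∀ f φ, ‖b f φ‖ ≤ c * (ultraSum U (fun d => ‖f.1 d‖ ^ r)) ^ (1 / r) * ‖φ‖ := by
  have hN : ∀ f : ultraLp 𝕜 n U hr, Tendsto (fun i => c * (∑ k, ‖f.1 ⟨i, k⟩‖ ^ r) ^ (1 / r)) U
      (𝓝 (c * (ultraSum U (fun d => ‖f.1 d‖ ^ r)) ^ (1 / r))) := fun f =>
    ((ultraBounded_of_mem f).tendsto.rpow_const (Or.inr (by positivity))).const_mul c
  have hle : ∀ (f : ultraLp 𝕜 n U hr) (φ : StrongDual 𝕜 Y) i,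
      ‖φ (∑ k, f.1 ⟨i, k⟩ • y i k)‖ ≤ ‖φ‖ * (c * (∑ k, ‖f.1 ⟨i, k⟩‖ ^ r) ^ (1 / r)) :=
    fun f φ i => (φ.le_opNorm _).trans (by gcongr; exact hy i _)
  have hex : ∀ (f : ultraLp 𝕜 n U hr) (φ : StrongDual 𝕜 Y), ∃ l,
      Tendsto (fun i => φ (∑ k, f.1 ⟨i, k⟩ • y i k)) U (𝓝 l) := fun f φ => by
    refine U.exists_tendsto_of_eventually_norm_le
      (C := ‖φ‖ * (c * (ultraSum U (fun d => ‖f.1 d‖ ^ r)) ^ (1 / r) + 1)) ?_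
    filter_upwards [(hN f).eventually_lt_const (lt_add_one _)] with i hi
    exact (hle f φ i).trans (by gcongr)
  choose l hl using hex
  have hlb : ∀ f φ, ‖l f φ‖ ≤ c * (ultraSum U (fun d => ‖f.1 d‖ ^ r)) ^ (1 / r) * ‖φ‖ :=
    fun f φ => le_of_tendsto_of_tendsto' (hl f φ).norm
      (by simpa only [mul_comm] using (hN f).const_mul ‖φ‖) (fun i => hle f φ i)
  refine ⟨
    { toFun := fun f => LinearMap.mkContinuous
        { toFun := l f
          map_add' := fun φ ψ => tendsto_nhds_unique (hl f (φ + ψ)) ((hl f φ).add (hl f ψ))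
          map_smul' := fun a φ => tendsto_nhds_unique (hl f (a • φ)) ((hl f φ).const_mul a) } _
        (hlb f)
      map_add' := fun f g => ?_
      map_smul' := fun a f => ?_ }, hl, hlb⟩
  · ext φ
    refine tendsto_nhds_unique (hl (f + g) φ) (((hl f φ).add (hl g φ)).congr fun i => ?_)
    rw [← map_add, ← Finset.sum_add_distrib]
    simp only [← add_smul]
    rfl
  · ext φ
    refine tendsto_nhds_unique (hl (a • f) φ) (((hl f φ).const_mul a).congr fun i => ?_)
    rw [← smul_eq_mul, ← map_smul, Finset.smul_sum]
    simp only [smul_smul]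
    rfl

/-- An operator that factors through an ultraproduct of spaces `ℓ_p^{n i}` factors through
`L_p`. -/
theorem gammaNorm_le_of_factor_ultraLp {E : Type u} [NormedAddCommGroup E] [NormedSpace 𝕜 E]
    [CompleteSpace E] (S : X →L[𝕜] E) (p : ℝ≥0∞) [Fact (1 ≤ p)] (hp : 0 < p.toReal)
    (ev : X →ₗ[𝕜] ultraLp 𝕜 n U hp) (b : ultraLp 𝕜 n U hp →ₗ[𝕜] E) {c : ℝ} (hc : 0 ≤ c)
    (hev : ∀ x, ultraSum U (fun d => ‖(ev x).1 d‖ ^ p.toReal) ≤ ‖x‖ ^ p.toReal)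
    (hb : ∀ f, ‖b f‖ ≤ c * (ultraSum U (fun d => ‖f.1 d‖ ^ p.toReal)) ^ (1 / p.toReal))
    (hS : ∀ x, b (ev x) = S x) :
    FactorsThroughLp p S ∧ gammaNorm p S ≤ ENNReal.ofReal c := by
  obtain ⟨Ω, mΩ, μ, R, hR, hnorm⟩ := exists_denseRange_ultraLp 𝕜 n U p hp
  have hev' : ∀ x, ‖R (ev x)‖ ≤ 1 * ‖x‖ := fun x => by
    rw [one_mul, ← Real.rpow_le_rpow_iff (norm_nonneg _) (norm_nonneg _) hp, hnorm]
    exact hev x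
  have hbR : ∀ f, ‖b f‖ ≤ c * ‖R f‖ := fun f => by
    refine (hb f).trans_eq ?_
    rw [← hnorm, ← Real.rpow_mul (norm_nonneg _), mul_one_div_cancel hp.ne', Real.rpow_one]
  have hfac : S = b.extendOfNorm R ∘L (R ∘ₗ ev).mkContinuous 1 hev' := by
    ext x
    exact ((LinearMap.extendOfNorm_eq hR ⟨c, hbR⟩ (ev x)).trans (hS x)).symm
  refine ⟨⟨Ω, mΩ, μ, _, _, hfac⟩, ?_⟩
  refine (iInf_le_of_le Ω <| iInf_le_of_le mΩ <| iInf_le_of_le μ <|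
    iInf_le_of_le ((R ∘ₗ ev).mkContinuous 1 hev') <| iInf_le_of_le (b.extendOfNorm R) <|
    iInf_le_of_le hfac le_rfl).trans ?_
  have hA : ‖(R ∘ₗ ev).mkContinuous 1 hev'‖ₑ ≤ 1 := by
    rw [← ofReal_norm, ENNReal.ofReal_le_one]
    exact LinearMap.mkContinuous_norm_le _ zero_le_one _
  have hB : ‖b.extendOfNorm R‖ₑ ≤ ENNReal.ofReal c := by
    rw [← ofReal_norm]
    exact ENNReal.ofReal_le_ofReal (LinearMap.opNorm_extendOfNorm_le hR hc hbR)
  exact (mul_le_mul' hA hB).trans (one_mul _).le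

/-- Limit of factorizations through `ℓ_p^{n i}` along an ultrafilter: an operator which is the limit
of `x ↦ ∑ k, ξ i k x • y i k` factors, as a map into the bidual, through the ultraproduct. -/
theorem gammaNorm_toBidual_le_of_tendsto (T : X →L[𝕜] Y) (p : ℝ≥0∞) [Fact (1 ≤ p)]
    (hp : 0 < p.toReal) {c : ℝ} (hc : 0 ≤ c) (ξ : ∀ i, Fin (n i) → X →ₗ[𝕜] 𝕜)
    (y : ∀ i, Fin (n i) → Y) {δ : ι → ℝ} (hδ : Tendsto δ U (𝓝 0))
    (hy : ∀ i (a : Fin (n i) → 𝕜),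
      ‖∑ k, a k • y i k‖ ≤ c * (∑ k, ‖a k‖ ^ p.toReal) ^ (1 / p.toReal))
    (hξ : ∀ x, ∀ᶠ i in (U : Filter ι), ∑ k, ‖ξ i k x‖ ^ p.toReal ≤ ‖x‖ ^ p.toReal + δ i)
    (hT : ∀ x, Tendsto (fun i => ∑ k, ξ i k x • y i k) U (𝓝 (T x))) :
    FactorsThroughLp (𝕜 := 𝕜) (Y := StrongDual 𝕜 (StrongDual 𝕜 Y)) p (toBidual T) ∧
      gammaNorm (𝕜 := 𝕜) (Y := StrongDual 𝕜 (StrongDual 𝕜 Y)) p (toBidual T) ≤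
        ENNReal.ofReal c := by
  obtain ⟨b, hb, hbn⟩ := exists_ultraLp_toBidual (𝕜 := 𝕜) (U := U) (hr := hp) y hy
  have hδ' : ∀ x : X, Tendsto (fun i => ‖x‖ ^ p.toReal + δ i) U (𝓝 (‖x‖ ^ p.toReal)) := fun x => by
    simpa using hδ.const_add (‖x‖ ^ p.toReal)
  have hbdd : ∀ x, UltraBounded U (fun d : Σ i, Fin (n i) => ‖ξ d.1 d.2 x‖ ^ p.toReal) := fun x => by
    refine ⟨‖x‖ ^ p.toReal + 1, ?_⟩
    filter_upwards [hξ x, (hδ' x).eventually_le_const (lt_add_one _)] with i hi hi'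
    exact (Finset.sum_le_sum fun k _ => (abs_of_nonneg (by positivity)).le).trans (hi.trans hi')
  let ev : X →ₗ[𝕜] ultraLp 𝕜 n U hp :=
    { toFun := fun x => ⟨fun d => ξ d.1 d.2 x, hbdd x⟩
      map_add' := fun x x' => by ext d; simp
      map_smul' := fun a x => by ext d; simp }
  have hev : ∀ x, ultraSum U (fun d => ‖(ev x).1 d‖ ^ p.toReal) ≤ ‖x‖ ^ p.toReal := fun x =>
    le_of_tendsto_of_tendsto (hbdd x).tendsto (hδ' x) (hξ x)
  have hbT : ∀ x, b (ev x) = toBidual T x := fun x => by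
    ext φ
    exact tendsto_nhds_unique (hb (ev x) φ) ((φ.continuous.tendsto (T x)).comp (hT x))
  refine gammaNorm_le_of_factor_ultraLp (E := StrongDual 𝕜 (StrongDual 𝕜 Y)) (toBidual T) p hp ev b
    hc hev (fun f => ?_) hbT
  refine ContinuousLinearMap.opNorm_le_bound _ (mul_nonneg hc (Real.rpow_nonneg ?_ _)) (hbn f)
  exact ultraSum_nonneg (ultraBounded_of_mem f) fun _ => by positivity

/-- The index set is directed by the finite sets of points at which `T` is approximated together
with the quality `1 / (N + 1)` of the approximation. -/
theorem gammaNorm_toBidual_le_of_approxFactorization (T : X →L[𝕜] Y) (p : ℝ≥0∞) [Fact (1 ≤ p)]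
    (hp : p ≠ ∞) {c : ℝ} (hc : 0 ≤ c)
    (h : ∀ (s : Finset X) (ε : ℝ), 0 < ε → Nonempty (ApproxFactorization T p.toReal c s ε)) :
    FactorsThroughLp (𝕜 := 𝕜) (Y := StrongDual 𝕜 (StrongDual 𝕜 Y)) p (toBidual T) ∧
      gammaNorm (𝕜 := 𝕜) (Y := StrongDual 𝕜 (StrongDual 𝕜 Y)) p (toBidual T) ≤
        ENNReal.ofReal c := by
  classical
  have hr : 0 < p.toReal := ENNReal.toReal_pos (zero_lt_one.trans_le Fact.out).ne' hp
  have hF : ∀ i : Finset X × ℕ, Nonempty (ApproxFactorization T p.toReal c i.1 (1 / (i.2 + 1))) :=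
    fun i => h _ _ Nat.one_div_pos_of_nat
  let F := fun i => (hF i).some
  let U : Ultrafilter (Finset X × ℕ) := Ultrafilter.of atTop
  have hU : (U : Filter (Finset X × ℕ)) ≤ atTop := Ultrafilter.of_le _
  have hmem : ∀ x, ∀ᶠ i in (U : Filter (Finset X × ℕ)), x ∈ i.1 := fun x => by
    refine Filter.Eventually.filter_mono hU ?_
    filter_upwards [eventually_ge_atTop (({x} : Finset X), 0)] with i hi
    exact hi.1 (Finset.mem_singleton_self x)
  have hε : Tendsto (fun i : Finset X × ℕ => 1 / ((i.2 : ℝ) + 1)) U (𝓝 0) :=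
    tendsto_one_div_add_atTop_nhds_zero_nat.comp ((tendsto_snd.mono_left
      prod_atTop_atTop_eq.ge).mono_left hU)
  refine gammaNorm_toBidual_le_of_tendsto (U := U) T p hr hc (fun i => (F i).ξ) (fun i => (F i).y)
    hε (fun i => (F i).norm_sum_smul_le) (fun x => ?_) fun x => ?_
  · filter_upwards [hmem x] with i hi using (F i).sum_norm_le x hi
  · rw [tendsto_iff_norm_sub_tendsto_zero]
    refine squeeze_zero' (Eventually.of_forall fun _ => norm_nonneg _) ?_ hε
    filter_upwards [hmem x] with i hi using (F i).norm_sub_le x hi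

end Limit

/-! ### Hölder duality for finite sequences -/

section Holder

variable {σ : Type*} [Fintype σ] {p q : ℝ≥0∞}

theorem exponent_cases (hpq : p.HolderConjugate q) (hp : p ≠ ∞) :
    (p = 1 ∧ q = ∞) ∨ (1 < p.toReal ∧ q ≠ ∞ ∧ p.toReal.HolderConjugate q.toReal) := by
  by_cases hq : q = ∞
  · refine Or.inl ⟨?_, hq⟩
    have := hpq.inv_add_inv_eq_inv
    simpa [hq] using this
  · have h := ENNReal.HolderConjugate.toReal_of_ne_top hp hq
    exact Or.inr ⟨h.lt, hq, h⟩

theorem sum_mul_le_piLp_norm_mul [Fact (1 ≤ q)] (hpq : p.HolderConjugate q) (hp : p ≠ ∞)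
    {E : Type*} [SeminormedAddCommGroup E] (b : PiLp q (fun _ : σ => E)) {v : σ → ℝ}
    (hv : ∀ j, 0 ≤ v j) :
    ∑ j, ‖b j‖ * v j ≤ ‖b‖ * (∑ j, v j ^ p.toReal) ^ (1 / p.toReal) := by
  rcases exponent_cases hpq hp with ⟨rfl, rfl⟩ | ⟨h1, hq, h⟩
  · simp only [ENNReal.toReal_one, Real.rpow_one, div_one, Finset.mul_sum]
    exact Finset.sum_le_sum fun j _ => mul_le_mul_of_nonneg_right (PiLp.norm_apply_le b j) (hv j)
  · rw [PiLp.norm_eq_sum h.symm.pos]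
    simpa [abs_of_nonneg (hv _)] using Real.inner_le_Lp_mul_Lq Finset.univ (fun j => ‖b j‖) v h.symm

/-- Every sequence `v` is normed by a sequence in the unit ball of `ℓ_q`. -/
theorem exists_piLp_norming {𝕜 : Type*} [RCLike 𝕜] [Fact (1 ≤ q)] (hpq : p.HolderConjugate q)
    (hp : p ≠ ∞) (v : σ → 𝕜) :
    ∃ b : PiLp q (fun _ : σ => 𝕜), ‖b‖ ≤ 1 ∧
      ∑ j, b j * v j = (((∑ j, ‖v j‖ ^ p.toReal) ^ (1 / p.toReal) : ℝ) : 𝕜) := by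
  have hsgn : ∀ j, ∃ z : 𝕜, ‖z‖ = 1 ∧ z * v j = (‖v j‖ : 𝕜) := fun j => by
    rcases eq_or_ne (v j) 0 with h | h
    · exact ⟨1, by simp, by simp [h]⟩
    · refine ⟨(‖v j‖ : 𝕜) / v j, ?_, div_mul_cancel₀ _ h⟩
      rw [norm_div, RCLike.norm_ofReal, abs_norm, div_self (norm_ne_zero_iff.2 h)]
  choose z hz hzv using hsgn
  rcases exponent_cases hpq hp with ⟨rfl, rfl⟩ | ⟨h1, hq, h⟩
  · refine ⟨WithLp.toLp _ z, ?_, by simp [hzv]⟩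
    rw [PiLp.norm_eq_ciSup]
    exact Real.iSup_le (fun j => (hz j).le) zero_le_one
  · set S : ℝ := ∑ j, ‖v j‖ ^ p.toReal with hS
    have hS0 : 0 ≤ S := Finset.sum_nonneg fun j _ => by positivity
    rcases hS0.eq_or_lt with h0 | h0
    · refine ⟨0, by simp, ?_⟩
      rw [← h0, Real.zero_rpow (by simpa using h.ne_zero)]
      simp
    refine ⟨WithLp.toLp _ fun j => z j * ((‖v j‖ ^ (p.toReal - 1) * S ^ (1 / p.toReal - 1) : ℝ) : 𝕜),
      ?_, ?_⟩
    · rw [PiLp.norm_eq_sum h.symm.pos]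
      refine Real.rpow_le_one (Finset.sum_nonneg fun j _ => by positivity) (le_of_eq ?_)
        (by positivity)
      have e1 : (p.toReal - 1) * q.toReal = p.toReal := h.sub_one_mul_conj
      have e2 : (1 / p.toReal - 1) * q.toReal = -1 := by
        have := h.one_sub_inv
        have hq0 := h.symm.ne_zero
        rw [one_div, show p.toReal⁻¹ - 1 = -(1 - p.toReal⁻¹) by ring, this]
        field_simp
      have : ∀ j, ‖z j * ((‖v j‖ ^ (p.toReal - 1) * S ^ (1 / p.toReal - 1) : ℝ) : 𝕜)‖ ^ q.toReal =
          ‖v j‖ ^ p.toReal * S⁻¹ := fun j => by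
        rw [norm_mul, hz, one_mul, RCLike.norm_ofReal, abs_of_nonneg (by positivity),
          Real.mul_rpow (by positivity) (by positivity), ← Real.rpow_mul (norm_nonneg _), e1,
          ← Real.rpow_mul hS0, e2, Real.rpow_neg_one]
      simp only [this]
      rw [← Finset.sum_mul, mul_inv_cancel₀ h0.ne']
    · have : ∀ j, z j * ((‖v j‖ ^ (p.toReal - 1) * S ^ (1 / p.toReal - 1) : ℝ) : 𝕜) * v j =
          ((‖v j‖ ^ p.toReal * S ^ (1 / p.toReal - 1) : ℝ) : 𝕜) := fun j => by
        have e : ‖v j‖ ^ (p.toReal - 1) * ‖v j‖ = ‖v j‖ ^ p.toReal := by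
          rcases (norm_nonneg (v j)).eq_or_lt with h' | h'
          · rw [← h', mul_zero, Real.zero_rpow h.ne_zero]
          · rw [Real.rpow_sub_one h'.ne', div_mul_cancel₀ _ h'.ne']
        rw [mul_right_comm, hzv, ← RCLike.ofReal_mul, ← e]
        congr 1
        ring
      simp only [this]
      rw [← RCLike.ofReal_sum, ← Finset.sum_mul, ← hS, Real.rpow_sub_one h0.ne', mul_div_cancel₀ _ h0.ne']

/-- The norm of `ℓ_q` is attained at a sequence in the unit ball of `ℓ_p`. -/
theorem exists_norming_piLp {𝕜 : Type*} [RCLike 𝕜] [Fact (1 ≤ q)] (hpq : p.HolderConjugate q)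
    (hp : p ≠ ∞) (v : PiLp q (fun _ : σ => 𝕜)) :
    ∃ c : σ → 𝕜, (∑ j, ‖c j‖ ^ p.toReal) ^ (1 / p.toReal) ≤ 1 ∧ ∑ j, c j * v j = (‖v‖ : 𝕜) := by
  classical
  rcases exponent_cases hpq hp with ⟨rfl, rfl⟩ | ⟨h1, hq, h⟩
  · rcases isEmpty_or_nonempty σ with hσ | hσ
    · refine ⟨0, by simp, ?_⟩
      rw [PiLp.norm_eq_ciSup]
      simp
    · obtain ⟨j, hj⟩ := exists_eq_ciSup_of_finite (f := fun j => ‖v j‖)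
      have hz : ∃ z : 𝕜, ‖z‖ = 1 ∧ z * v j = (‖v j‖ : 𝕜) := by
        rcases eq_or_ne (v j) 0 with h | h
        · exact ⟨1, by simp, by simp [h]⟩
        · refine ⟨(‖v j‖ : 𝕜) / v j, ?_, div_mul_cancel₀ _ h⟩
          rw [norm_div, RCLike.norm_ofReal, abs_norm, div_self (norm_ne_zero_iff.2 h)]
      obtain ⟨z, hz, hzv⟩ := hz
      refine ⟨Pi.single j z, ?_, ?_⟩
      · simp only [ENNReal.toReal_one, Real.rpow_one, div_one]
        rw [Finset.sum_eq_single j (fun i _ hi => by simp [hi]) (by simp)]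
        simp [hz]
      · rw [Finset.sum_eq_single j (fun i _ hi => by simp [hi]) (by simp), Pi.single_eq_same, hzv,
          PiLp.norm_eq_ciSup, ← hj]
  · have : Fact (1 ≤ p) := ⟨ENNReal.HolderConjugate.one_le p q⟩
    obtain ⟨b, hb, hbv⟩ := exists_piLp_norming hpq.symm hq (fun j => v j)
    refine ⟨fun j => b j, ?_, ?_⟩
    · rwa [PiLp.norm_eq_sum h.pos] at hb
    · rw [hbv, PiLp.norm_eq_sum h.symm.pos]

end Holder

/-! ### Summing operators -/

section Summing

variable {𝕜 : Type} [RCLike 𝕜]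
  {X : Type v} [NormedAddCommGroup X] [NormedSpace 𝕜 X]
  {Y : Type w} [NormedAddCommGroup Y] [NormedSpace 𝕜 Y]

theorem strongNorm_ne_top (q : ℝ≥0∞) {n : ℕ} (x : Fin n → X) : strongNorm q x ≠ ∞ :=
  ENNReal.rpow_ne_top_of_nonneg (by positivity) (ENNReal.sum_ne_top.2 fun _ _ =>
    ENNReal.rpow_ne_top_of_nonneg ENNReal.toReal_nonneg enorm_ne_top)

theorem strongNorm_mono {q : ℝ≥0∞} {n : ℕ} {x : Fin n → X} {y : Fin n → Y}
    (h : ∀ i, ‖x i‖ₑ ≤ ‖y i‖ₑ) : strongNorm q x ≤ strongNorm q y := by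
  unfold strongNorm
  gcongr with i
  exact h i

theorem strongNorm_smul {q : ℝ≥0∞} (hq : 0 < q.toReal) {n : ℕ} (a : 𝕜) (x : Fin n → X) :
    strongNorm q (fun i => a • x i) = ‖a‖ₑ * strongNorm q x := by
  unfold strongNorm
  simp only [enorm_smul, ENNReal.mul_rpow_of_nonneg _ _ hq.le]
  rw [← Finset.mul_sum, ENNReal.mul_rpow_of_nonneg _ _ (by positivity), ← ENNReal.rpow_mul,
    mul_one_div_cancel hq.ne', ENNReal.rpow_one]

theorem strongNorm_eq_enorm_toLp (q : ℝ≥0∞) [Fact (1 ≤ q)] (hq : 0 < q.toReal) {n : ℕ}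
    (x : Fin n → X) : strongNorm q x = ‖(WithLp.toLp q x : PiLp q (fun _ : Fin n => X))‖ₑ := by
  rw [← ofReal_norm, PiLp.norm_eq_sum hq, ← ENNReal.ofReal_rpow_of_nonneg
    (Finset.sum_nonneg fun _ _ => by positivity) (by positivity),
    ENNReal.ofReal_sum_of_nonneg fun _ _ => by positivity]
  simp only [strongNorm, ← ofReal_norm, ENNReal.ofReal_rpow_of_nonneg (norm_nonneg _) hq.le]

theorem weakNorm_ne_top (q : ℝ≥0∞) {n : ℕ} (x : Fin n → X) : weakNorm 𝕜 q x ≠ ∞ := by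
  refine ((iSup₂_le fun f hf => strongNorm_mono fun i => ?_).trans_lt
    (strongNorm_ne_top q x).lt_top).ne
  rw [enorm_le_iff_norm_le]
  exact (f.le_opNorm _).trans (mul_le_of_le_one_left (norm_nonneg _) hf)

theorem weakNorm_smul {q : ℝ≥0∞} (hq : 0 < q.toReal) {n : ℕ} (a : 𝕜) (x : Fin n → X) :
    weakNorm 𝕜 q (fun i => a • x i) = ‖a‖ₑ * weakNorm 𝕜 q x := by
  simp only [weakNorm, map_smul, strongNorm_smul hq, ENNReal.mul_iSup]

theorem eq_zero_of_weakNorm_eq_zero {q : ℝ≥0∞} (hq : 0 < q.toReal) {n : ℕ} {x : Fin n → X}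
    (h : weakNorm 𝕜 q x = 0) (i : Fin n) : x i = 0 := by
  obtain ⟨f, hf, hfx⟩ := exists_dual_vector'' 𝕜 (x i)
  have h1 : strongNorm q (fun i => f (x i)) = 0 :=
    le_zero_iff.1 (h ▸ le_iSup₂ (f := fun (f : StrongDual 𝕜 X) (_ : ‖f‖ ≤ 1) =>
      strongNorm q (fun i => f (x i))) f hf)
  unfold strongNorm at h1
  rw [ENNReal.rpow_eq_zero_iff_of_pos (by positivity), Finset.sum_eq_zero_iff] at h1
  have h2 : ‖f (x i)‖ₑ = 0 :=
    (ENNReal.rpow_eq_zero_iff_of_pos hq).1 (h1 i (Finset.mem_univ _))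
  rw [hfx, enorm_eq_zero] at h2
  simpa using h2

theorem strongNorm_le_summingNorm_mul {q : ℝ≥0∞} (hq : 0 < q.toReal) (T : X →L[𝕜] Y) {n : ℕ}
    (x : Fin n → X) : strongNorm q (fun i => T (x i)) ≤ summingNorm q T * weakNorm 𝕜 q x := by
  rw [summingNorm, if_neg (ENNReal.toReal_pos_iff.1 hq).2.ne]
  rcases eq_or_ne (weakNorm 𝕜 q x) 0 with h0 | h0
  · have : (fun i => T (x i)) = fun i => (0 : 𝕜) • T (x i) := by
      ext i
      simp [eq_zero_of_weakNorm_eq_zero hq h0 i]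
    rw [this, strongNorm_smul hq]
    simp
  simp only [ENNReal.iInf_mul' (fun h => (weakNorm_ne_top q x h).elim) (fun h => (h0 h).elim)]
  exact le_iInf₂ fun K hK => hK n x

/-- To bound the summing norm it suffices to test on families of weak norm at most `1`. -/
theorem summingNorm_le_of_weakNorm_le_one {q : ℝ≥0∞} (hq : 0 < q.toReal) (T : X →L[𝕜] Y) (K : ℝ≥0)
    (h : ∀ (n : ℕ) (x : Fin n → X), weakNorm 𝕜 q x ≤ 1 → strongNorm q (fun i => T (x i)) ≤ K) :
    summingNorm q T ≤ K := by
  have hq' := (ENNReal.toReal_pos_iff.1 hq).2.ne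
  rw [summingNorm, if_neg hq']
  refine iInf₂_le K fun n x => ?_
  rcases eq_or_ne (weakNorm 𝕜 q x) 0 with h0 | h0
  · have : (fun i => T (x i)) = fun i => (0 : 𝕜) • T (x i) := by
      ext i
      simp [eq_zero_of_weakNorm_eq_zero hq h0 i]
    rw [this, strongNorm_smul hq]
    simp
  · set t : ℝ≥0∞ := weakNorm 𝕜 q x with ht
    have ht' : t ≠ ∞ := weakNorm_ne_top q x
    set a : 𝕜 := (((t.toReal)⁻¹ : ℝ) : 𝕜) with ha
    have hae : ‖a‖ₑ = t⁻¹ := by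
      have : 0 < t.toReal := ENNReal.toReal_pos h0 ht'
      rw [← ofReal_norm, ha, RCLike.norm_ofReal, abs_of_nonneg (by positivity),
        ENNReal.ofReal_inv_of_pos this, ENNReal.ofReal_toReal ht']
    have h1 := h n (fun i => a • x i) (by
      rw [weakNorm_smul hq, hae, ← ht, ENNReal.inv_mul_cancel h0 ht'])
    simp only [map_smul] at h1
    rw [strongNorm_smul hq, hae] at h1
    rwa [mul_comm, ← div_eq_mul_inv, ENNReal.div_le_iff h0 ht'] at h1

/-- If every bounded operator from a Banach space `E` to `Y` is `q`-summing then the `q`-summing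
norm is bounded by a multiple of the operator norm, by uniform boundedness. -/
theorem exists_summingNorm_le_mul_enorm [CompleteSpace Y] {q : ℝ≥0∞} (hq : 1 ≤ q)
    (h : ∀ U : X →L[𝕜] Y, IsSumming q U) :
    ∃ C : ℝ≥0, ∀ U : X →L[𝕜] Y, summingNorm q U ≤ C * ‖U‖ₑ := by
  rcases eq_or_ne q ∞ with rfl | hq'
  · exact ⟨1, fun U => by simp [summingNorm]⟩
  have : Fact (1 ≤ q) := ⟨hq⟩
  have hq0 : 0 < q.toReal := ENNReal.toReal_pos (zero_lt_one.trans_le hq).ne' hq'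
  let Idx := {x : Σ n, Fin n → X // weakNorm 𝕜 q x.2 ≤ 1}
  let L : ∀ x : Idx, (X →L[𝕜] Y) →L[𝕜] PiLp q (fun _ : Fin x.1.1 => Y) := fun x =>
    (PiLp.continuousLinearEquiv q 𝕜 (fun _ : Fin x.1.1 => Y)).symm.toContinuousLinearMap ∘L
      ContinuousLinearMap.pi fun j => ContinuousLinearMap.apply 𝕜 Y (x.1.2 j)
  let P : Idx → Seminorm 𝕜 (X →L[𝕜] Y) := fun x =>
    (normSeminorm 𝕜 (PiLp q (fun _ : Fin x.1.1 => Y))).comp (L x).toLinearMap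
  have hPe : ∀ x U, ENNReal.ofReal (P x U) = strongNorm q (fun i => U (x.1.2 i)) := fun x U => by
    rw [strongNorm_eq_enorm_toLp q hq0, ← ofReal_norm]
    rfl
  have hPc : ∀ x, Continuous (P x) := fun x => continuous_norm.comp (L x).continuous
  have hbdd : BddAbove (Set.range P) := by
    rw [Seminorm.bddAbove_range_iff]
    intro U
    refine ⟨(summingNorm q U).toReal, ?_⟩
    rintro _ ⟨x, rfl⟩
    rw [← ENNReal.ofReal_le_iff_le_toReal (h U).ne, hPe]
    exact (strongNorm_le_summingNorm_mul hq0 U x.1.2).trans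
      (mul_le_of_le_one_right zero_le x.2)
  have hcont : Continuous (⨆ x, P x : Seminorm 𝕜 (X →L[𝕜] Y)) := by
    rw [Seminorm.coe_iSup_eq hbdd]
    exact Seminorm.continuous_iSup P hPc hbdd
  obtain ⟨C, hC0, hC⟩ := Seminorm.bound_of_continuous_normedSpace _ hcont
  refine ⟨C.toNNReal, fun U => ?_⟩
  have := summingNorm_le_of_weakNorm_le_one hq0 U (C.toNNReal * ‖U‖₊) fun n x hx => ?_
  · rwa [ENNReal.coe_mul] at this
  · have h1 : P ⟨⟨n, x⟩, hx⟩ U ≤ C * ‖U‖ := by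
      refine le_trans ?_ (hC U)
      rw [Seminorm.coe_iSup_eq hbdd, iSup_apply]
      exact le_ciSup (f := fun x => P x U)
        ((Seminorm.bddAbove_range_iff).1 hbdd U) (⟨⟨n, x⟩, hx⟩ : Idx)
    have h2 := ENNReal.ofReal_le_ofReal h1
    rw [hPe, ENNReal.ofReal_mul hC0.le, ofReal_norm] at h2
    exact h2

theorem ellInftySummingConst_lt_top [CompleteSpace Y] {q : ℝ≥0∞} (hq : 1 ≤ q)
    (h : ∀ U : EllInfty 𝕜 →L[𝕜] Y, IsSumming q U) : ellInftySummingConst 𝕜 Y q < ∞ := by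
  obtain ⟨C, hC⟩ := exists_summingNorm_le_mul_enorm hq h
  exact (iInf₂_le C hC).trans_lt ENNReal.coe_lt_top

end Summing

/-! ### Adjoints of operators dominated by finitely many points -/

section EllInfty

variable {𝕜 : Type} [RCLike 𝕜] {p q : ℝ≥0∞} [Fact (1 ≤ q)]

/-- A weakly `ℓ_q`-bounded family is mapped by a `q`-summing operator to a strongly
`ℓ_q`-bounded one; `q = ∞` is allowed. -/
theorem norm_toLp_map_le_of_summingNorm_le
    {E : Type v} [NormedAddCommGroup E] [NormedSpace 𝕜 E]
    {F : Type w} [NormedAddCommGroup F] [NormedSpace 𝕜 F]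
    {U : E →L[𝕜] F} {K : ℝ≥0} (hK : summingNorm q U ≤ K) {m : ℕ} (a : Fin m → E)
    (ha : ∀ f : StrongDual 𝕜 E, ‖f‖ ≤ 1 →
      ‖(WithLp.toLp q (fun j => f (a j)) : PiLp q (fun _ : Fin m => 𝕜))‖ ≤ 1) :
    ‖(WithLp.toLp q (fun j => U (a j)) : PiLp q (fun _ : Fin m => F))‖ ≤ K := by
  rcases eq_or_ne q ∞ with rfl | hq
  · rw [summingNorm, if_pos rfl] at hK
    have hK' : ‖U‖ ≤ K := by
      have : ‖U‖₊ ≤ K := by exact_mod_cast hK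
      exact_mod_cast this
    rw [PiLp.norm_eq_ciSup]
    refine Real.iSup_le (fun j => ?_) K.2
    obtain ⟨f, hf, hfa⟩ := exists_dual_vector'' 𝕜 (a j)
    have h1 : ‖f (a j)‖ ≤ 1 := (PiLp.norm_apply_le
      (WithLp.toLp ∞ (fun j => f (a j)) : PiLp ∞ (fun _ : Fin m => 𝕜)) j).trans (ha f hf)
    rw [hfa, RCLike.norm_ofReal, abs_norm] at h1
    calc ‖U (a j)‖ ≤ ‖U‖ * ‖a j‖ := U.le_opNorm _
      _ ≤ K * 1 := by gcongr
      _ = K := mul_one _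
  · have hq0 : 0 < q.toReal :=
      ENNReal.toReal_pos (zero_lt_one.trans_le (Fact.out : (1 : ℝ≥0∞) ≤ q)).ne' hq
    have h1 : weakNorm 𝕜 q a ≤ 1 := by
      refine iSup₂_le fun f hf => ?_
      rw [strongNorm_eq_enorm_toLp q hq0, ← ofReal_norm]
      exact ENNReal.ofReal_le_one.2 (ha f hf)
    have h2 := (strongNorm_le_summingNorm_mul hq0 U a).trans (mul_le_mul' hK h1)
    rw [strongNorm_eq_enorm_toLp q hq0, mul_one, ← ofReal_norm] at h2
    exact (ENNReal.ofReal_le_ofReal_iff K.2).1 (by simpa using h2)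

/-- If operators from `ℓ_∞` to `F` are `q`-summing with `π_q(U) ≤ C ‖U‖`, then for a weakly
absolutely summable family `x` in `F` the vectors `(φ_j (x i))_j ∈ ℓ_p` are absolutely summable.
This is the `q`-summing inequality of the operator `e_i ↦ x i`, applied to the columns of a matrix
whose rows are norming functionals for those vectors. -/
theorem sum_rpow_sum_norm_apply_le (hpq : p.HolderConjugate q) (hp : p ≠ ∞)
    {F : Type v} [NormedAddCommGroup F] [NormedSpace 𝕜 F] {C : ℝ≥0}
    (hC : ∀ U : EllInfty 𝕜 →L[𝕜] F, summingNorm q U ≤ C * ‖U‖ₑ) {m n : ℕ} (x : Fin m → F)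
    (φ : Fin n → StrongDual 𝕜 F) {W : ℝ≥0}
    (hW : ∀ a : Fin m → 𝕜, ‖∑ i, a i • x i‖ ≤ W * ‖a‖) :
    ∑ i, (∑ j, ‖φ j (x i)‖ ^ p.toReal) ^ (1 / p.toReal) ≤
      C * W * (∑ j, ‖φ j‖ ^ p.toReal) ^ (1 / p.toReal) := by
  choose b hb hbv using fun i => exists_piLp_norming hpq hp (fun j => φ j (x i))
  have hb1 : ∀ i j, ‖b i j‖ ≤ 1 := fun i j => (PiLp.norm_apply_le (b i) j).trans (hb i)
  let a : Fin n → EllInfty 𝕜 := fun j =>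
    ⟨fun k => if h : k < m then b ⟨k, h⟩ j else 0, memℓp_infty ⟨1, by
      rintro _ ⟨k, rfl⟩
      by_cases h : k < m
      · simpa [h] using hb1 _ _
      · simp [h]⟩⟩
  have ha : ∀ (j : Fin n) (k : ℕ), a j k = if h : k < m then b ⟨k, h⟩ j else 0 := fun _ _ => rfl
  let U : EllInfty 𝕜 →L[𝕜] F := LinearMap.mkContinuous
    { toFun := fun f => ∑ i : Fin m, (f : ∀ _ : ℕ, 𝕜) i • x i
      map_add' := fun f g => by simp [add_smul, Finset.sum_add_distrib]
      map_smul' := fun c f => by simp [mul_smul, Finset.smul_sum] } W fun f => by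
    refine (hW _).trans ?_
    gcongr
    exact (pi_norm_le_iff_of_nonneg (norm_nonneg _)).2 fun i =>
      lp.norm_apply_le_norm ENNReal.top_ne_zero f i
  have hU : ‖U‖ ≤ W := LinearMap.mkContinuous_norm_le _ W.2 _
  have hUa : ∀ j, U (a j) = ∑ i, b i j • x i := fun j => by
    change ∑ i : Fin m, (a j : ∀ _ : ℕ, 𝕜) i • x i = _
    exact Finset.sum_congr rfl fun i _ => by rw [ha, dif_pos i.2]
  have hsum : summingNorm q U ≤ ((C * W : ℝ≥0) : ℝ≥0∞) := by
    rw [ENNReal.coe_mul]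
    refine (hC U).trans ?_
    gcongr
    exact enorm_le_coe.2 hU
  have hweak := norm_toLp_map_le_of_summingNorm_le hsum a fun f hf => by
    obtain ⟨c, hc, hcv⟩ := exists_norming_piLp hpq hp
      (WithLp.toLp q (fun j => f (a j)) : PiLp q (fun _ : Fin n => 𝕜))
    have h1 : ‖∑ j, c j • a j‖ ≤ 1 := by
      refine lp.norm_le_of_forall_le zero_le_one fun k => ?_
      have : (∑ j, c j • a j : EllInfty 𝕜) k = ∑ j, c j * a j k := by
        rw [lp.coeFn_sum]
        exact Finset.sum_apply k _ _
      rw [this]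
      by_cases hk : k < m
      · simp only [ha, dif_pos hk]
        calc ‖∑ j, c j * b ⟨k, hk⟩ j‖ ≤ ∑ j, ‖b ⟨k, hk⟩ j‖ * ‖c j‖ :=
              (norm_sum_le _ _).trans_eq (by simp [mul_comm])
          _ ≤ ‖b ⟨k, hk⟩‖ * (∑ j, ‖c j‖ ^ p.toReal) ^ (1 / p.toReal) :=
              sum_mul_le_piLp_norm_mul hpq hp _ fun j => norm_nonneg _
          _ ≤ 1 := mul_le_one₀ (hb _) (by positivity) hc
      · simp [ha, hk]
    have h2 : f (∑ j, c j • a j) = (‖(WithLp.toLp q (fun j => f (a j)) :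
        PiLp q (fun _ : Fin n => 𝕜))‖ : 𝕜) := by
      rw [← hcv]
      simp
    calc _ = ‖f (∑ j, c j • a j)‖ := by rw [h2, RCLike.norm_ofReal, abs_norm]
      _ ≤ ‖f‖ * ‖∑ j, c j • a j‖ := f.le_opNorm _
      _ ≤ 1 := mul_le_one₀ hf (norm_nonneg _) h1
  have key : ((∑ i, (∑ j, ‖φ j (x i)‖ ^ p.toReal) ^ (1 / p.toReal) : ℝ) : 𝕜) =
      ∑ j, φ j (U (a j)) := by
    simp only [hUa, map_sum, map_smul, smul_eq_mul]
    rw [Finset.sum_comm]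
    exact Finset.sum_congr rfl fun i _ => (hbv i).symm
  calc ∑ i, (∑ j, ‖φ j (x i)‖ ^ p.toReal) ^ (1 / p.toReal)
      = ‖((∑ i, (∑ j, ‖φ j (x i)‖ ^ p.toReal) ^ (1 / p.toReal) : ℝ) : 𝕜)‖ := by
        rw [RCLike.norm_ofReal, abs_of_nonneg (by positivity)]
    _ ≤ ∑ j, ‖U (a j)‖ * ‖φ j‖ := by
        rw [key]
        refine (norm_sum_le _ _).trans (Finset.sum_le_sum fun j _ => ?_)
        rw [mul_comm]
        exact (φ j).le_opNorm _
    _ ≤ _ := sum_mul_le_piLp_norm_mul hpq hp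
        (WithLp.toLp q (fun j => U (a j)) : PiLp q (fun _ : Fin n => F)) fun j => norm_nonneg _
    _ ≤ _ := by
        gcongr
        exact_mod_cast hweak

theorem norm_sum_smul_le_weakNorm {E : Type v} [NormedAddCommGroup E] [NormedSpace 𝕜 E] {m : ℕ}
    (x : Fin m → E) (a : Fin m → 𝕜) : ‖∑ i, a i • x i‖ ≤ (weakNorm 𝕜 1 x).toNNReal * ‖a‖ := by
  obtain ⟨f, hf, hfx⟩ := exists_dual_vector'' 𝕜 (∑ i, a i • x i)
  have h1 : strongNorm 1 (fun i => f (x i)) ≤ weakNorm 𝕜 1 x :=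
    le_iSup₂ (f := fun (f : StrongDual 𝕜 E) (_ : ‖f‖ ≤ 1) => strongNorm 1 (fun i => f (x i))) f hf
  have h2 : ∑ i, ‖f (x i)‖ ≤ (weakNorm 𝕜 1 x).toNNReal := by
    rw [ENNReal.coe_toNNReal_eq_toReal, ← ENNReal.ofReal_le_iff_le_toReal (weakNorm_ne_top 1 x)]
    refine le_trans (le_of_eq ?_) h1
    rw [ENNReal.ofReal_sum_of_nonneg fun _ _ => norm_nonneg _]
    simp [strongNorm]
  calc ‖∑ i, a i • x i‖ = ‖f (∑ i, a i • x i)‖ := by rw [hfx, RCLike.norm_ofReal, abs_norm]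
    _ ≤ ∑ i, ‖a‖ * ‖f (x i)‖ := by
        simp only [map_sum, map_smul, smul_eq_mul]
        refine (norm_sum_le _ _).trans (Finset.sum_le_sum fun i _ => ?_)
        rw [norm_mul]
        gcongr
        exact norm_le_pi_norm a i
    _ ≤ _ := by
        rw [← Finset.mul_sum, mul_comm]
        gcongr

/-- If `S : Z → X` is dominated by the `ℓ_p` sum of the points `w j`, then the adjoint of
`T ∘ S` is absolutely summing. -/
theorem summingNorm_adj_comp_le (hpq : p.HolderConjugate q) (hp : p ≠ ∞)
    {X : Type v} [NormedAddCommGroup X] [NormedSpace 𝕜 X]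
    {Y : Type w} [NormedAddCommGroup Y] [NormedSpace 𝕜 Y]
    {Z : Type*} [NormedAddCommGroup Z] [NormedSpace 𝕜 Z] {C : ℝ≥0}
    (hC : ∀ U : EllInfty 𝕜 →L[𝕜] StrongDual 𝕜 X, summingNorm q U ≤ C * ‖U‖ₑ)
    (T : X →L[𝕜] Y) (S : Z →L[𝕜] X) {n : ℕ} (w : Fin n → X)
    (hS : ∀ (f : StrongDual 𝕜 X) z,
      ‖f (S z)‖ ≤ (∑ j, ‖f (w j)‖ ^ p.toReal) ^ (1 / p.toReal) * ‖z‖) :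
    summingNorm 1 (adj (T ∘L S)) ≤
      ENNReal.ofReal (C * ‖T‖ * (∑ j, ‖w j‖ ^ p.toReal) ^ (1 / p.toReal)) := by
  set τ : ℝ := (∑ j, ‖w j‖ ^ p.toReal) ^ (1 / p.toReal) with hτ
  have hτ0 : 0 ≤ τ := by positivity
  rw [summingNorm, if_neg ENNReal.one_ne_top]
  refine iInf₂_le (Real.toNNReal (C * ‖T‖ * τ)) fun m y => ?_
  have h := sum_rpow_sum_norm_apply_le hpq hp hC (fun i => (y i) ∘L T)
    (fun j => NormedSpace.inclusionInDoubleDual 𝕜 X (w j))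
    (W := (weakNorm 𝕜 1 y).toNNReal * ‖T‖₊) fun a => by
      have : ∑ i, a i • (y i ∘L T) = (∑ i, a i • y i) ∘L T := by
        ext z
        simp
      rw [this]
      calc _ ≤ ‖∑ i, a i • y i‖ * ‖T‖ := ContinuousLinearMap.opNorm_comp_le _ _
        _ ≤ ((weakNorm 𝕜 1 y).toNNReal * ‖a‖) * ‖T‖ := by
            gcongr
            exact norm_sum_smul_le_weakNorm y a
        _ = _ := by push_cast; ring
  have hw : (∑ j, ‖NormedSpace.inclusionInDoubleDual 𝕜 X (w j)‖ ^ p.toReal) ^ (1 / p.toReal) ≤ τ := by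
    rw [hτ]
    gcongr with j
    exact NormedSpace.double_dual_bound 𝕜 X (w j)
  have h3 : ∑ i, ‖adj (T ∘L S) (y i)‖ ≤ (C * ‖T‖ * τ) * (weakNorm 𝕜 1 y).toNNReal := by
    calc ∑ i, ‖adj (T ∘L S) (y i)‖
        ≤ ∑ i, (∑ j, ‖y i (T (w j))‖ ^ p.toReal) ^ (1 / p.toReal) :=
          Finset.sum_le_sum fun i _ => ContinuousLinearMap.opNorm_le_bound _ (by positivity)
            fun z => hS ((y i) ∘L T) z
      _ ≤ _ := h
      _ ≤ C * ((weakNorm 𝕜 1 y).toNNReal * ‖T‖₊ : ℝ≥0) * τ := by gcongr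
      _ = _ := by push_cast; ring
  calc strongNorm 1 (fun i => adj (T ∘L S) (y i))
      = ENNReal.ofReal (∑ i, ‖adj (T ∘L S) (y i)‖) := by
        rw [ENNReal.ofReal_sum_of_nonneg fun _ _ => norm_nonneg _]
        simp [strongNorm]
    _ ≤ ENNReal.ofReal ((C * ‖T‖ * τ) * (weakNorm 𝕜 1 y).toNNReal) := ENNReal.ofReal_le_ofReal h3
    _ = _ := by
        rw [ENNReal.ofReal_mul (by positivity), ENNReal.ofReal_coe_nnreal,
          ENNReal.coe_toNNReal (weakNorm_ne_top 1 y)]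
        rfl

end EllInfty

/-! ### Discretizing operators into `L_p` -/

section Discretize

variable {𝕜 : Type} [RCLike 𝕜] {Ω : Type*} {mΩ : MeasurableSpace Ω} {μ : Measure Ω}
  [IsFiniteMeasure μ] {p : ℝ≥0∞}

/-- The function of `L_p(μ)` obtained by relabelling the values of a simple function `φ` by `h`. -/
def mapToLp {V : Type*} (φ : SimpleFunc Ω V) (p : ℝ≥0∞) (μ : Measure Ω) [IsFiniteMeasure μ]
    (h : V → 𝕜) : Lp 𝕜 p μ :=
  (SimpleFunc.memLp_of_isFiniteMeasure (φ.map h) p μ).toLp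

theorem norm_mapToLp [Fact (1 ≤ p)] (hp : p ≠ ∞) {V : Type*} (φ : SimpleFunc Ω V) (h : V → 𝕜) :
    ‖mapToLp φ p μ h‖ =
      (∑ v ∈ φ.range, ‖h v‖ ^ p.toReal * μ.real (φ ⁻¹' {v})) ^ (1 / p.toReal) := by
  have hp0 : p ≠ 0 := (zero_lt_one.trans_le (Fact.out : (1 : ℝ≥0∞) ≤ p)).ne'
  have hr : 0 < p.toReal := ENNReal.toReal_pos hp0 hp
  rw [mapToLp, Lp.norm_toLp, eLpNorm_eq_lintegral_rpow_enorm_toReal hp0 hp, ← ENNReal.toReal_rpow]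
  congr 1
  have h1 : ∫⁻ ω, ‖(φ.map h) ω‖ₑ ^ p.toReal ∂μ =
      ∫⁻ ω, (φ.map fun v => ‖h v‖ₑ ^ p.toReal) ω ∂μ := rfl
  rw [h1, SimpleFunc.lintegral_eq_lintegral, SimpleFunc.map_lintegral, ENNReal.toReal_sum]
  · refine Finset.sum_congr rfl fun v _ => ?_
    rw [ENNReal.toReal_mul, ← ENNReal.toReal_rpow, toReal_enorm]
    rfl
  · exact fun v _ => ENNReal.mul_ne_top (ENNReal.rpow_ne_top_of_nonneg hr.le enorm_ne_top)
      (measure_ne_top _ _)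

theorem mapToLp_eq_sum {V : Type*} [DecidableEq V] (φ : SimpleFunc Ω V) (h : V → 𝕜) :
    mapToLp φ p μ h = ∑ v : φ.range, h v • mapToLp φ p μ (Pi.single v.1 1) := by
  let E : (V → 𝕜) →ₗ[𝕜] Lp 𝕜 p μ :=
    { toFun := mapToLp φ p μ
      map_add' := fun _ _ => rfl
      map_smul' := fun _ _ => rfl }
  have h1 : ∀ h, mapToLp φ p μ h = E h := fun _ => rfl
  simp only [h1]
  simp only [← map_smul, ← map_sum]
  refine (MemLp.toLp_eq_toLp_iff (SimpleFunc.memLp_of_isFiniteMeasure (φ.map _) p μ)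
    (SimpleFunc.memLp_of_isFiniteMeasure (φ.map _) p μ)).2 ?_
  refine Eventually.of_forall fun ω => ?_
  simp only [SimpleFunc.coe_map, Function.comp_apply, Finset.sum_apply, Pi.smul_apply]
  rw [Finset.sum_eq_single (⟨φ ω, φ.mem_range_self ω⟩ : φ.range)]
  · simp
  · intro b _ hb
    have : φ ω ≠ b.1 := fun h => hb (Subtype.ext h.symm)
    simp [this]
  · simp

/-- A finite-rank family of functions in `L_p(μ)` is approximately contained in the isometric copy
of `ℓ_p^n` spanned by the normalized indicators of the level sets of a simple function. -/
theorem exists_discretization [Fact (1 ≤ p)] (hp : p ≠ ∞) {Z : Type*} [NormedAddCommGroup Z] [NormedSpace 𝕜 Z]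
    [FiniteDimensional 𝕜 Z] (G : Z →ₗ[𝕜] Lp 𝕜 p μ) {m : ℕ} (z : Fin m → Z) {η : ℝ} (hη : 0 < η) :
    ∃ (n : ℕ) (ζ : Fin n → Z →ₗ[𝕜] 𝕜) (g : Fin n → Lp 𝕜 p μ),
      (∀ a : Fin n → 𝕜, ‖∑ k, a k • g k‖ ≤ (∑ k, ‖a k‖ ^ p.toReal) ^ (1 / p.toReal)) ∧
      (∀ j, ‖∑ k, ζ k (z j) • g k - G (z j)‖ ≤ η) ∧
      ∀ j, (∑ k, ‖ζ k (z j)‖ ^ p.toReal) ^ (1 / p.toReal) ≤ ‖G (z j)‖ + η := by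
  classical
  have hp0 : p ≠ 0 := (zero_lt_one.trans_le (Fact.out : (1 : ℝ≥0∞) ≤ p)).ne'
  have hr : 0 < p.toReal := ENNReal.toReal_pos hp0 hp
  let b := Module.finBasis 𝕜 Z
  let κ := Fin (Module.finrank 𝕜 Z)
  let P : Z →ₗ[𝕜] ((κ → 𝕜) →L[𝕜] 𝕜) := b.constr 𝕜 fun i => ContinuousLinearMap.proj i
  have hPb : ∀ i, P (b i) = ContinuousLinearMap.proj i := fun i => b.constr_basis 𝕜 _ i
  have hF : MemLp (fun ω (i : κ) => G (b i) ω) p μ := MemLp.of_eval fun i => Lp.memLp (G (b i))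
  let F : Lp (κ → 𝕜) p μ := hF.toLp
  let Q : Z →ₗ[𝕜] Lp 𝕜 p μ :=
    { toFun := fun z => (P z).compLp F
      map_add' := fun x y => by rw [map_add, ContinuousLinearMap.add_compLp]
      map_smul' := fun c x => by rw [map_smul, ContinuousLinearMap.smul_compLp]; rfl }
  have hQ : Q = G := b.ext fun i => by
    change (P (b i)).compLp F = G (b i)
    refine Lp.ext ?_
    filter_upwards [ContinuousLinearMap.coeFn_compLp (P (b i)) F,
      hF.coeFn_toLp] with ω h1 h2
    rw [h1, hPb, h2]
    rfl
  set M : ℝ := 1 + ∑ j, ‖P (z j)‖ with hM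
  have hM0 : 0 < M := by positivity
  have hMj : ∀ j, ‖P (z j)‖ ≤ M := fun j =>
    (Finset.single_le_sum (f := fun j => ‖P (z j)‖) (fun _ _ => norm_nonneg _)
      (Finset.mem_univ j)).trans (by rw [hM]; linarith)
  obtain ⟨φ, hφ, hφm⟩ := hF.exists_simpleFunc_eLpNorm_sub_lt hp
    (ε := ENNReal.ofReal (η / M)) (by simpa using div_pos hη hM0)
  have hφF : ‖hφm.toLp - F‖ ≤ η / M := by
    rw [← MemLp.toLp_sub, Lp.norm_toLp, eLpNorm_sub_comm]
    exact ENNReal.toReal_le_of_le_ofReal (by positivity) hφ.le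
  have hE : ∀ z, mapToLp φ p μ (P z) = (P z).compLp hφm.toLp := fun z => by
    refine Lp.ext ?_
    filter_upwards [ContinuousLinearMap.coeFn_compLp (P z) hφm.toLp, hφm.coeFn_toLp,
      (SimpleFunc.memLp_of_isFiniteMeasure (φ.map (P z)) p μ).coeFn_toLp] with ω h1 h2 h3
    rw [h1, h2, mapToLp, h3]
    rfl
  have hclose : ∀ j, ‖mapToLp φ p μ (P (z j)) - G (z j)‖ ≤ η := fun j => by
    have : mapToLp φ p μ (P (z j)) - G (z j) = (P (z j)).compLpL p μ (hφm.toLp - F) := by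
      rw [map_sub, hE, ← hQ]
      rfl
    rw [this]
    calc _ ≤ ‖P (z j)‖ * ‖hφm.toLp - F‖ := ContinuousLinearMap.norm_compLp_le _ _
      _ ≤ M * (η / M) := by
          gcongr
          exact hMj j
      _ = η := mul_div_cancel₀ _ hM0.ne'
  let A : φ.range → ℝ := fun v => μ.real (φ ⁻¹' {v.1})
  have hA0 : ∀ v, 0 ≤ A v := fun v => measureReal_nonneg
  -- A null level set has `A v = 0`, and then both `A v ^ (1 / r)` and its inverse are `0`.
  have hAr : ∀ v, (A v ^ (1 / p.toReal)) ^ p.toReal = A v := fun v => by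
    rw [← Real.rpow_mul (hA0 v), one_div_mul_cancel hr.ne', Real.rpow_one]
  let s : φ.range → ℝ := fun v => A v ^ (1 / p.toReal)
  have hs0 : ∀ v, 0 ≤ s v := fun v => Real.rpow_nonneg (hA0 v) _
  let e : φ.range → Lp 𝕜 p μ := fun v => mapToLp φ p μ (Pi.single v.1 1)
  have he : ∀ v, ‖e v‖ = s v := fun v => by
    rw [norm_mapToLp hp, Finset.sum_eq_single v.1]
    · simp [A, s]
    · intro b _ hb
      simp [hb, hr.ne']
    · exact fun h => (h v.2).elim
  let ζ : φ.range → Z →ₗ[𝕜] 𝕜 := fun v =>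
    (s v : 𝕜) • ((ContinuousLinearMap.coeLM 𝕜 : ((κ → 𝕜) →L[𝕜] 𝕜) →ₗ[𝕜] _).flip v.1 ∘ₗ P)
  have hζ : ∀ v z, ζ v z = s v * P z v.1 := fun v z => rfl
  let g : φ.range → Lp 𝕜 p μ := fun v => ((s v)⁻¹ : 𝕜) • e v
  have hg : ∀ a : φ.range → 𝕜,
      ‖∑ v, a v • g v‖ ≤ (∑ v, ‖a v‖ ^ p.toReal) ^ (1 / p.toReal) := fun a => by
    let h : (κ → 𝕜) → 𝕜 := fun v => if hv : v ∈ φ.range then a ⟨v, hv⟩ * ((s ⟨v, hv⟩ : 𝕜))⁻¹ else 0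
    have hh : ∀ v : φ.range, h v = a v * ((s v : 𝕜))⁻¹ := fun v => dif_pos v.2
    have h1 : ∑ v, a v • g v = mapToLp φ p μ h := by
      rw [mapToLp_eq_sum]
      exact Finset.sum_congr rfl fun v _ => by rw [hh, mul_smul]
    rw [h1, norm_mapToLp hp, ← Finset.sum_coe_sort]
    gcongr with v
    rw [hh, norm_mul, norm_inv, RCLike.norm_ofReal, abs_of_nonneg (hs0 v),
      Real.mul_rpow (norm_nonneg _) (inv_nonneg.2 (hs0 v)), Real.inv_rpow (hs0 v), hAr, mul_assoc]
    exact mul_le_of_le_one_right (by positivity) (inv_mul_le_one (a := A v))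
  have hζg : ∀ z, ∑ v, ζ v z • g v = mapToLp φ p μ (P z) := fun z => by
    rw [mapToLp_eq_sum]
    refine Finset.sum_congr rfl fun v _ => ?_
    rcases eq_or_ne (s v) 0 with h0 | h0
    · have : e v = 0 := norm_eq_zero.1 ((he v).trans h0)
      change ζ v z • ((s v)⁻¹ : 𝕜) • e v = P z v.1 • e v
      rw [this]
      simp
    · rw [hζ, smul_smul, mul_right_comm, mul_inv_cancel₀ (by exact_mod_cast h0), one_mul]
  have hζn : ∀ z, (∑ v, ‖ζ v z‖ ^ p.toReal) ^ (1 / p.toReal) = ‖mapToLp φ p μ (P z)‖ := fun z => by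
    rw [norm_mapToLp hp, ← Finset.sum_coe_sort φ.range]
    refine congrArg (· ^ (1 / p.toReal)) (Finset.sum_congr rfl fun v _ => ?_)
    rw [hζ, norm_mul, RCLike.norm_ofReal, abs_of_nonneg (hs0 v),
      Real.mul_rpow (hs0 v) (norm_nonneg _), hAr, mul_comm]
  let ε := Fintype.equivFin φ.range
  refine ⟨Fintype.card φ.range, fun k => ζ (ε.symm k), fun k => g (ε.symm k),
    fun a => ?_, fun j => ?_, fun j => ?_⟩
  · rw [← ε.sum_comp fun k => a k • g (ε.symm k), ← ε.sum_comp (fun k => ‖a k‖ ^ p.toReal)]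
    simpa using hg fun v => a (ε v)
  · rw [ε.symm.sum_comp (fun v => ζ v (z j) • g v), hζg]
    exact hclose j
  · rw [ε.symm.sum_comp (fun v => ‖ζ v (z j)‖ ^ p.toReal), hζn]
    have := norm_le_norm_add_norm_sub' (mapToLp φ p μ (P (z j))) (G (z j))
    linarith [hclose j]

end Discretize

/-! ### The inclusion of `L_∞` into `L_p`, and finite-dimensional quotients of `ℓ_q` -/

section LInfty

variable {𝕜 : Type} [RCLike 𝕜] {p q : ℝ≥0∞} [Fact (1 ≤ q)]

theorem enorm_rpow_eq_lintegral [Fact (1 ≤ p)] {Ω : Type*} {mΩ : MeasurableSpace Ω} {μ : Measure Ω}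
    (hp : p ≠ ∞) (f : Lp 𝕜 p μ) : ‖f‖ₑ ^ p.toReal = ∫⁻ ω, ‖f ω‖ₑ ^ p.toReal ∂μ := by
  have hp0 : p ≠ 0 := (zero_lt_one.trans_le (Fact.out : (1 : ℝ≥0∞) ≤ p)).ne'
  have hr : 0 < p.toReal := ENNReal.toReal_pos hp0 hp
  rw [Lp.enorm_def, eLpNorm_eq_lintegral_rpow_enorm_toReal hp0 hp, ← ENNReal.rpow_mul,
    one_div_mul_cancel hr.ne', ENNReal.rpow_one]

/-- The formal inclusion `L_∞(μ) → L_p(μ)` takes the weak `ℓ_p` norm to the strong `ℓ_p` norm: a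
family whose linear combinations are bounded by the `ℓ_q` norm of the coefficients is pointwise
almost everywhere bounded in `ℓ_p`. -/
theorem sum_norm_inclusion_rpow_le [Fact (1 ≤ p)] {Ω : Type*} {mΩ : MeasurableSpace Ω} {μ : Measure Ω}
    [IsProbabilityMeasure μ] (hpq : p.HolderConjugate q) (hp : p ≠ ∞) {m : ℕ}
    (f : Fin m → Lp 𝕜 ∞ μ) {M : ℝ} (hM0 : 0 ≤ M)
    (hM : ∀ v : PiLp q (fun _ : Fin m => 𝕜), ‖∑ j, v j • f j‖ ≤ M * ‖v‖) :
    ∑ j, ‖(AddSubgroup.inclusion (Lp.antitone le_top) (f j) : Lp 𝕜 p μ)‖ ^ p.toReal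
      ≤ M ^ p.toReal := by
  have hp0 : p ≠ 0 := (zero_lt_one.trans_le (Fact.out : (1 : ℝ≥0∞) ≤ p)).ne'
  have hr : 0 < p.toReal := ENNReal.toReal_pos hp0 hp
  let D := TopologicalSpace.denseSeq (PiLp q (fun _ : Fin m => 𝕜))
  have h1 : ∀ᵐ ω ∂μ, ∀ i, ‖∑ j, D i j * f j ω‖ ≤ M * ‖D i‖ := by
    rw [ae_all_iff]
    intro i
    have h2 : ∀ᵐ ω ∂μ, (∑ j, D i j • f j : Lp 𝕜 ∞ μ) ω = ∑ j, D i j * f j ω := by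
      have : ∀ᵐ ω ∂μ, ∀ j, (D i j • f j : Lp 𝕜 ∞ μ) ω = D i j * f j ω := by
        rw [ae_all_iff]
        intro j
        filter_upwards [Lp.coeFn_smul (D i j) (f j)] with ω h
        rw [h]
        rfl
      filter_upwards [this, Lp.coeFn_finsetSum Finset.univ (fun j => D i j • f j)] with ω h h'
      rw [h', Finset.sum_apply]
      exact Finset.sum_congr rfl fun j _ => h j
    have h3 : ∀ᵐ ω ∂μ, ‖(∑ j, D i j • f j : Lp 𝕜 ∞ μ) ω‖ₑ ≤ ‖(∑ j, D i j • f j : Lp 𝕜 ∞ μ)‖ₑ := by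
      rw [Lp.enorm_def, eLpNorm_exponent_top]
      exact ae_le_eLpNormEssSup
    filter_upwards [h2, h3] with ω h h'
    rw [h, enorm_le_iff_norm_le] at h'
    exact h'.trans (hM _)
  have h4 : ∀ᵐ ω ∂μ, ∑ j, ‖f j ω‖ ^ p.toReal ≤ M ^ p.toReal := by
    filter_upwards [h1] with ω h
    have h5 : ∀ v : PiLp q (fun _ : Fin m => 𝕜), ‖∑ j, v j * f j ω‖ ≤ M * ‖v‖ := fun v => by
      refine (TopologicalSpace.denseRange_denseSeq _).induction_on
        (p := fun v : PiLp q (fun _ : Fin m => 𝕜) => ‖∑ j, v j * f j ω‖ ≤ M * ‖v‖) v ?_ h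
      exact isClosed_le (by fun_prop) (by fun_prop)
    obtain ⟨b, hb, hbv⟩ := exists_piLp_norming hpq hp (fun j => f j ω)
    have h6 := h5 b
    rw [hbv, RCLike.norm_ofReal, abs_of_nonneg (by positivity)] at h6
    have h7 := h6.trans (mul_le_of_le_one_right hM0 hb)
    rwa [one_div, Real.rpow_inv_le_iff_of_pos (by positivity) hM0 hr] at h7
  have h8 : ∀ j, ‖(AddSubgroup.inclusion (Lp.antitone le_top) (f j) : Lp 𝕜 p μ)‖ₑ ^ p.toReal =
      ∫⁻ ω, ‖f j ω‖ₑ ^ p.toReal ∂μ := fun j => enorm_rpow_eq_lintegral hp _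
  have h9 : ∑ j, ‖(AddSubgroup.inclusion (Lp.antitone le_top) (f j) : Lp 𝕜 p μ)‖ₑ ^ p.toReal
      ≤ ENNReal.ofReal (M ^ p.toReal) := by
    simp only [h8]
    rw [← lintegral_finsetSum' _ fun j _ =>
      ((Lp.aestronglyMeasurable (f j)).enorm.pow_const _)]
    calc _ ≤ ∫⁻ _, ENNReal.ofReal (M ^ p.toReal) ∂μ := by
          refine lintegral_mono_ae ?_
          filter_upwards [h4] with ω h
          refine le_trans (le_of_eq ?_) (ENNReal.ofReal_le_ofReal h)
          rw [ENNReal.ofReal_sum_of_nonneg fun _ _ => by positivity]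
          simp only [← ofReal_norm, ENNReal.ofReal_rpow_of_nonneg (norm_nonneg _) hr.le]
      _ = _ := by simp
  rw [← ENNReal.ofReal_le_ofReal_iff (by positivity)]
  refine le_trans (le_of_eq ?_) h9
  rw [ENNReal.ofReal_sum_of_nonneg fun _ _ => by positivity]
  simp only [← ofReal_norm, ENNReal.ofReal_rpow_of_nonneg (norm_nonneg _) hr.le]

/-- The span of finitely many vectors `w j`, with the quotient norm of `ℓ_q^m`, as a
finite-dimensional space `Z` with an injection into `X`. -/
theorem exists_quotient_span (hpq : p.HolderConjugate q) (hp : p ≠ ∞)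
    {X : Type u} [NormedAddCommGroup X] [NormedSpace 𝕜 X] {m : ℕ} (w : Fin m → X) :
    ∃ (Z : Type u) (_ : NormedAddCommGroup Z) (_ : NormedSpace 𝕜 Z) (_ : FiniteDimensional 𝕜 Z)
      (S : Z →L[𝕜] X) (e : Fin m → Z), Function.Injective S ∧ (∀ j, S (e j) = w j) ∧
      (∀ (f : StrongDual 𝕜 X) z,
        ‖f (S z)‖ ≤ (∑ j, ‖f (w j)‖ ^ p.toReal) ^ (1 / p.toReal) * ‖z‖) ∧
      ∀ v : PiLp q (fun _ : Fin m => 𝕜), ‖∑ j, v j • e j‖ ≤ ‖v‖ := by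
  let V := PiLp q (fun _ : Fin m => 𝕜)
  let S₀ : V →ₗ[𝕜] X :=
    { toFun := fun v => ∑ j, v j • w j
      map_add' := fun a b => by
        rw [← Finset.sum_add_distrib]
        exact Finset.sum_congr rfl fun j _ => add_smul (a j) (b j) (w j)
      map_smul' := fun c a => by
        refine Eq.trans ?_ Finset.smul_sum.symm
        exact Finset.sum_congr rfl fun j _ => mul_smul c (a j) (w j) }
  let N : Submodule 𝕜 V := LinearMap.ker S₀
  have hN : IsClosed (N : Set V) := N.closed_of_finiteDimensional
  let Z₀ := V ⧸ N
  let S₁ : Z₀ →ₗ[𝕜] X := N.liftQ S₀ le_rfl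
  have hS₁ : Function.Injective S₁ := LinearMap.ker_eq_bot.1 (N.ker_liftQ_eq_bot' S₀ rfl)
  have hfin : FiniteDimensional 𝕜 (ULift.{u} Z₀) :=
    LinearEquiv.finiteDimensional (ULift.moduleEquiv (R := 𝕜) (M := Z₀)).symm
  let S₂ : ULift.{u} Z₀ →ₗ[𝕜] X := S₁ ∘ₗ (ULift.moduleEquiv (R := 𝕜) (M := Z₀)).toLinearMap
  have hlift : ∀ v : V, S₂ ⟨N.mkQ v⟩ = ∑ j, v j • w j := fun v => rfl
  have hmk : ∀ v : V, (⟨N.mkQ v⟩ : ULift.{u} Z₀) =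
      ∑ j, v j • (⟨N.mkQ (PiLp.single q j 1)⟩ : ULift.{u} Z₀) := fun v => by
    let E : V →ₗ[𝕜] ULift.{u} Z₀ :=
      (ULift.moduleEquiv (R := 𝕜) (M := Z₀)).symm.toLinearMap ∘ₗ N.mkQ
    have hv : v = ∑ j, v j • (PiLp.single q j 1 : V) := by
      ext i
      rw [WithLp.ofLp_sum, Finset.sum_apply, Finset.sum_eq_single i]
      · simp
      · intro j _ hj
        simp [hj.symm]
      · simp
    change E v = ∑ j, v j • E (PiLp.single q j 1)
    conv_lhs => rw [hv]
    simp only [map_sum, map_smul]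
  refine ⟨ULift.{u} Z₀, inferInstance, inferInstance, hfin,
    LinearMap.toContinuousLinearMap S₂, fun j => ⟨N.mkQ (PiLp.single q j 1)⟩, ?_, ?_, ?_, ?_⟩
  · exact hS₁.comp ULift.down_injective
  · intro j
    change S₂ _ = _
    rw [hlift]
    simp
  · rintro f ⟨z⟩
    set τ : ℝ := (∑ j, ‖f (w j)‖ ^ p.toReal) ^ (1 / p.toReal) with hτ
    have hτ0 : 0 ≤ τ := by positivity
    have hv : ∀ v : V, N.mkQ v = z → ‖f (S₂ ⟨z⟩)‖ ≤ τ * ‖v‖ := by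
      rintro v rfl
      rw [hlift, map_sum, mul_comm]
      refine ((norm_sum_le _ _).trans_eq ?_).trans
        (sum_mul_le_piLp_norm_mul hpq hp v fun j => norm_nonneg (f (w j)))
      simp
    change ‖f (S₂ ⟨z⟩)‖ ≤ τ * ‖z‖
    rcases hτ0.eq_or_lt with h0 | h0
    · obtain ⟨v, hvz⟩ := N.mkQ_surjective z
      simpa [← h0] using hv v hvz
    · rw [← div_le_iff₀' h0]
      exact QuotientAddGroup.le_norm_iff.2 fun v hvz => (div_le_iff₀' h0).2 (hv v hvz)
  · intro v
    rw [← hmk]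
    exact Submodule.Quotient.norm_mk_le N v

end LInfty

/-! ### Factorization at finitely many points -/

section Local

variable {𝕜 : Type} [RCLike 𝕜] {p q : ℝ≥0∞} [Fact (1 ≤ p)] [Fact (1 ≤ q)]

/-- The formal inclusion `L_∞(μ) → L_p(μ)`. -/
def lpInclusion {Ω : Type*} {mΩ : MeasurableSpace Ω} (μ : Measure Ω) [IsProbabilityMeasure μ]
    (p : ℝ≥0∞) [Fact (1 ≤ p)] : Lp 𝕜 ∞ μ →ₗ[𝕜] Lp 𝕜 p μ where
  toFun := AddSubgroup.inclusion (Lp.antitone le_top)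
  map_add' _ _ := rfl
  map_smul' _ _ := rfl

/-- The strict integral norm of the restriction of `T` to the span of finitely many vectors `w j`,
normed as a quotient of `ℓ_q^m`, is controlled through the property `GL(1, p)`. -/
theorem strictIntegralNorm_comp_le {X Y : Type u} [NormedAddCommGroup X] [NormedSpace 𝕜 X]
    [NormedAddCommGroup Y] [NormedSpace 𝕜 Y] (hpq : p.HolderConjugate q) (hp : p ≠ ∞)
    {C K : ℝ≥0} (hC : ∀ U : EllInfty 𝕜 →L[𝕜] StrongDual 𝕜 X, summingNorm q U ≤ C * ‖U‖ₑ)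
    (hK : GLBound 𝕜 Y 1 p K) (T : X →L[𝕜] Y) {m : ℕ} (w : Fin m → X)
    {Z : Type u} [NormedAddCommGroup Z] [NormedSpace 𝕜 Z] [FiniteDimensional 𝕜 Z] (S : Z →L[𝕜] X)
    (hS : ∀ (f : StrongDual 𝕜 X) z,
        ‖f (S z)‖ ≤ (∑ j, ‖f (w j)‖ ^ p.toReal) ^ (1 / p.toReal) * ‖z‖) :
    strictIntegralNorm p (T ∘L S) ≤
      ENNReal.ofReal (K * C * ‖T‖ * (∑ j, ‖w j‖ ^ p.toReal) ^ (1 / p.toReal)) := by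
  have : CompleteSpace Z := FiniteDimensional.complete 𝕜 Z
  refine (hK Z (T ∘L S) inferInstance).trans ?_
  grw [summingNorm_adj_comp_le hpq hp hC T S w hS]
  rw [← ENNReal.ofReal_coe_nnreal, ← ENNReal.ofReal_mul K.coe_nonneg]
  exact ENNReal.ofReal_le_ofReal (by simp only [mul_assoc]; rfl)

/-- For finitely many points `w j`, the map `T` is approximated there by a factorization through
`ℓ_p^n` with second factor of norm at most `c` whose first factor is controlled by the sum
`∑ j, ‖w j‖ ^ p` over all the points. It comes from a factorization `B ∘ j ∘ A` of `T` on the span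
of the `w j`, whose middle part in `L_p(μ)` is discretized. -/
theorem exists_local_factorization {X Y : Type u} [NormedAddCommGroup X] [NormedSpace 𝕜 X]
    [NormedAddCommGroup Y] [NormedSpace 𝕜 Y] (hpq : p.HolderConjugate q) (hp : p ≠ ∞)
    {C K : ℝ≥0} (hC : ∀ U : EllInfty 𝕜 →L[𝕜] StrongDual 𝕜 X, summingNorm q U ≤ C * ‖U‖ₑ)
    (hK : GLBound 𝕜 Y 1 p K) (T : X →L[𝕜] Y) {c : ℝ} (hc : K * C * ‖T‖ < c) {m : ℕ} (w : Fin m → X)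
    {δ : ℝ} (hδ : 0 < δ) :
    ∃ (n : ℕ) (ξ : Fin n → X →ₗ[𝕜] 𝕜) (y : Fin n → Y),
      (∀ a : Fin n → 𝕜, ‖∑ k, a k • y k‖ ≤ c * (∑ k, ‖a k‖ ^ p.toReal) ^ (1 / p.toReal)) ∧
      (∀ j, ‖∑ k, ξ k (w j) • y k - T (w j)‖ ≤ δ) ∧
      ∑ j, ∑ k, ‖ξ k (w j)‖ ^ p.toReal ≤ ∑ j, ‖w j‖ ^ p.toReal + δ := by
  have hp0 : p ≠ 0 := (zero_lt_one.trans_le (Fact.out : (1 : ℝ≥0∞) ≤ p)).ne'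
  have hr : 0 < p.toReal := ENNReal.toReal_pos hp0 hp
  have hc0 : 0 < c := lt_of_le_of_lt (by positivity) hc
  by_cases hTw : ∀ j, T (w j) = 0
  · refine ⟨0, Fin.elim0, Fin.elim0, fun a => ?_, fun j => ?_, ?_⟩
    · simp [hr.ne']
    · simp [hTw, hδ.le]
    · simp only [Finset.univ_eq_empty, Finset.sum_empty, Finset.sum_const_zero]
      positivity
  obtain ⟨Z, _, _, _, S, e, hSi, hSe, hS, he⟩ := exists_quotient_span (𝕜 := 𝕜) (q := q) hpq hp w
  set τ : ℝ := (∑ j, ‖w j‖ ^ p.toReal) ^ (1 / p.toReal) with hτ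
  have hτr : τ ^ p.toReal = ∑ j, ‖w j‖ ^ p.toReal := by
    rw [hτ, ← Real.rpow_mul (by positivity), one_div_mul_cancel hr.ne', Real.rpow_one]
  have hτ0 : 0 < τ := by
    push Not at hTw
    obtain ⟨j, hj⟩ := hTw
    have hwj : 0 < ‖w j‖ := norm_pos_iff.2 fun h => hj (by rw [h, map_zero])
    refine Real.rpow_pos_of_pos (lt_of_lt_of_le (Real.rpow_pos_of_pos hwj p.toReal)
      (Finset.single_le_sum (f := fun j => ‖w j‖ ^ p.toReal) (fun _ _ => by positivity)
        (Finset.mem_univ j))) _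
  have hlt : strictIntegralNorm p (T ∘L S) < ENNReal.ofReal (c * τ) :=
    (strictIntegralNorm_comp_le hpq hp hC hK T w S hS).trans_lt
      ((ENNReal.ofReal_lt_ofReal_iff (by positivity)).2 (by gcongr))
  unfold strictIntegralNorm at hlt
  simp only [iInf_lt_iff] at hlt
  obtain ⟨Ω, mΩ, μ, hμ, A, B, hAB, hlt⟩ := hlt
  have hlt' : ‖A‖ * ‖B‖ < c * τ := by
    rw [← ofReal_norm, ← ofReal_norm, ← ENNReal.ofReal_mul (norm_nonneg _)] at hlt
    exact (ENNReal.ofReal_lt_ofReal_iff (by positivity)).1 hlt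
  have hA0 : 0 < ‖A‖ := by
    refine norm_pos_iff.2 fun h => hTw fun j => ?_
    have := hAB (e j)
    rw [ContinuousLinearMap.comp_apply, hSe, h, zero_apply, map_zero,
      map_zero] at this
    exact this
  -- Both factors are rescaled so that the first one has `∑ j, ‖G (e j)‖ ^ p ≤ τ ^ p`.
  let G : Z →ₗ[𝕜] Lp 𝕜 p μ := ((τ / ‖A‖ : ℝ) : 𝕜) • (lpInclusion μ p ∘ₗ A.toLinearMap)
  let B' : Lp 𝕜 p μ →L[𝕜] Y := ((‖A‖ / τ : ℝ) : 𝕜) • B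
  have hBG : ∀ z, B' (G z) = T (S z) := fun z => by
    have h1 : B' (G z) = ((‖A‖ / τ : ℝ) : 𝕜) • B (((τ / ‖A‖ : ℝ) : 𝕜) • lpInclusion μ p (A z)) := rfl
    rw [h1, map_smul, smul_smul, ← RCLike.ofReal_mul,
      show ‖A‖ / τ * (τ / ‖A‖) = 1 by field_simp, RCLike.ofReal_one, one_smul]
    exact (hAB z).symm
  have hB' : ‖B'‖ ≤ c := by
    rw [norm_smul, RCLike.norm_ofReal, abs_of_nonneg (by positivity), div_mul_eq_mul_div,
      div_le_iff₀ hτ0]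
    exact hlt'.le
  have hG : ∑ j, ‖G (e j)‖ ^ p.toReal ≤ ∑ j, ‖w j‖ ^ p.toReal := by
    have h1 := sum_norm_inclusion_rpow_le hpq hp (fun j => A (e j)) (norm_nonneg A) fun v => by
      have : ∑ j, v j • A (e j) = A (∑ j, v j • e j) := by simp
      rw [this]
      exact (A.le_opNorm _).trans (by gcongr; exact he v)
    have h2 : ∀ j, ‖G (e j)‖ ^ p.toReal = (τ / ‖A‖) ^ p.toReal *
        ‖(AddSubgroup.inclusion (Lp.antitone le_top) (A (e j)) : Lp 𝕜 p μ)‖ ^ p.toReal := fun j => by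
      have : G (e j) = ((τ / ‖A‖ : ℝ) : 𝕜) •
        (AddSubgroup.inclusion (Lp.antitone le_top) (A (e j)) : Lp 𝕜 p μ) := rfl
      rw [this, norm_smul, RCLike.norm_ofReal, abs_of_nonneg (by positivity),
        Real.mul_rpow (by positivity) (norm_nonneg _)]
    simp only [h2]
    rw [← Finset.mul_sum, ← hτr]
    calc _ ≤ (τ / ‖A‖) ^ p.toReal * ‖A‖ ^ p.toReal := by gcongr
      _ = τ ^ p.toReal := by
        rw [← Real.mul_rpow (by positivity) (by positivity), div_mul_cancel₀ _ hA0.ne']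
  obtain ⟨η, hη, hη1, hη2⟩ : ∃ η : ℝ, 0 < η ∧ c * η ≤ δ ∧
      ∑ j, (‖G (e j)‖ + η) ^ p.toReal ≤ ∑ j, ‖w j‖ ^ p.toReal + δ := by
    have h1 : Tendsto (fun η : ℝ => c * η) (𝓝[>] 0) (𝓝 0) := by
      have : ContinuousAt (fun η : ℝ => c * η) 0 := by fun_prop
      simpa using this.tendsto.mono_left nhdsWithin_le_nhds
    have h2 : Tendsto (fun η : ℝ => ∑ j, (‖G (e j)‖ + η) ^ p.toReal) (𝓝[>] 0)
        (𝓝 (∑ j, ‖G (e j)‖ ^ p.toReal)) := by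
      have : ContinuousAt (fun η : ℝ => ∑ j, (‖G (e j)‖ + η) ^ p.toReal) 0 := by
        refine Continuous.continuousAt (continuous_finsetSum _ fun j _ => ?_)
        exact (continuous_const.add continuous_id).rpow_const fun _ => Or.inr hr.le
      simpa using this.tendsto.mono_left nhdsWithin_le_nhds
    obtain ⟨η, ⟨h3, h4⟩, h5⟩ := ((h1.eventually_le_const hδ).and
      (h2.eventually_le_const (lt_add_of_pos_right _ hδ))).and self_mem_nhdsWithin |>.exists
    exact ⟨η, h5, h3, h4.trans (by gcongr)⟩
  obtain ⟨n, ζ, g, hg, hζg, hζ⟩ := exists_discretization hp G e hη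
  obtain ⟨L, hL⟩ := LinearMap.exists_leftInverse_of_injective S.toLinearMap
    (LinearMap.ker_eq_bot.2 hSi)
  have hLw : ∀ j, L (w j) = e j := fun j => by
    rw [← hSe]
    exact LinearMap.congr_fun hL (e j)
  refine ⟨n, fun k => ζ k ∘ₗ L, fun k => B' (g k), fun a => ?_, fun j => ?_, ?_⟩
  · have : ∑ k, a k • B' (g k) = B' (∑ k, a k • g k) := by simp
    rw [this]
    exact (B'.le_opNorm _).trans (by gcongr; exact hg a)
  · have : ∑ k, (ζ k ∘ₗ L) (w j) • B' (g k) - T (w j) =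
        B' (∑ k, ζ k (e j) • g k - G (e j)) := by
      simp [hLw, hBG, hSe]
    rw [this]
    exact (B'.le_opNorm _).trans ((mul_le_mul hB' (hζg j) (norm_nonneg _) hc0.le).trans hη1)
  · refine le_trans (Finset.sum_le_sum fun j _ => ?_) hη2
    have h1 := hζ j
    rw [one_div, Real.rpow_inv_le_iff_of_pos (by positivity) (by positivity) hr] at h1
    simpa [hLw] using h1

end Local

/-! ### From summed to pointwise control, by convexity -/

section Convexity

variable {𝕜 : Type} [RCLike 𝕜] {X Y : Type u} [NormedAddCommGroup X] [NormedSpace 𝕜 X]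
  [NormedAddCommGroup Y] [NormedSpace 𝕜 Y]

/-- The vectors `v` dominating `(∑ k, ‖ξ k (x j)‖ ^ r)_j` for some factorization
`∑ k, ξ k ⊗ y k` through `ℓ_r^n` that is `ε`-close to `T` at the points `x j` and whose second
factor, `a ↦ ∑ k, a k • y k`, has norm at most `c`. -/
def dominatingVectors (T : X →L[𝕜] Y) (r c ε : ℝ) {m : ℕ} (x : Fin m → X) : Set (Fin m → ℝ) :=
  {v | ∃ (n : ℕ) (ξ : Fin n → X →ₗ[𝕜] 𝕜) (y : Fin n → Y),
    (∀ a : Fin n → 𝕜, ‖∑ k, a k • y k‖ ≤ c * (∑ k, ‖a k‖ ^ r) ^ (1 / r)) ∧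
    (∀ j, ‖∑ k, ξ k (x j) • y k - T (x j)‖ ≤ ε) ∧ ∀ j, ∑ k, ‖ξ k (x j)‖ ^ r ≤ v j}

/-- The direct sum of two factorizations, weighted by `α ^ (1 / r)` and `α ^ (1 - 1 / r)` on its
two factors, realizes convex combinations. -/
theorem convex_dominatingVectors (T : X →L[𝕜] Y) {r c : ℝ} (hr : 1 ≤ r) (hc : 0 ≤ c) (ε : ℝ)
    {m : ℕ} (x : Fin m → X) : Convex ℝ (dominatingVectors T r c ε x) := by
  have hr0 : 0 < r := zero_lt_one.trans_le hr
  rw [convex_iff_forall_pos]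
  rintro v₁ ⟨n₁, ξ₁, y₁, h₁, h₁', h₁''⟩ v₂ ⟨n₂, ξ₂, y₂, h₂, h₂', h₂''⟩ α β hα hβ hαβ
  have hp : ∀ {t : ℝ}, 0 < t → (t ^ (1 / r)) ^ r = t := fun ht => by
    rw [← Real.rpow_mul ht.le, one_div_mul_cancel hr0.ne', Real.rpow_one]
  have hp' : ∀ {t : ℝ}, 0 < t → t ^ (1 / r) * t ^ (1 - 1 / r) = t := fun ht => by
    rw [← Real.rpow_add ht, add_sub_cancel, Real.rpow_one]
  refine ⟨n₁ + n₂, Fin.append (fun k => ((α ^ (1 / r) : ℝ) : 𝕜) • ξ₁ k)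
    (fun k => ((β ^ (1 / r) : ℝ) : 𝕜) • ξ₂ k), Fin.append
    (fun k => ((α ^ (1 - 1 / r) : ℝ) : 𝕜) • y₁ k) (fun k => ((β ^ (1 - 1 / r) : ℝ) : 𝕜) • y₂ k),
    fun a => ?_, fun j => ?_, fun j => ?_⟩
  · simp only [Fin.sum_univ_add, Fin.append_left, Fin.append_right]
    set A₁ : ℝ := (∑ k, ‖a (Fin.castAdd n₂ k)‖ ^ r) ^ (1 / r) with hA₁
    set A₂ : ℝ := (∑ k, ‖a (Fin.natAdd n₁ k)‖ ^ r) ^ (1 / r) with hA₂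
    have hA₁0 : 0 ≤ A₁ := by positivity
    have hA₂0 : 0 ≤ A₂ := by positivity
    have e₁ : A₁ ^ r = ∑ k, ‖a (Fin.castAdd n₂ k)‖ ^ r := by
      rw [hA₁, ← Real.rpow_mul (by positivity), one_div_mul_cancel hr0.ne', Real.rpow_one]
    have e₂ : A₂ ^ r = ∑ k, ‖a (Fin.natAdd n₁ k)‖ ^ r := by
      rw [hA₂, ← Real.rpow_mul (by positivity), one_div_mul_cancel hr0.ne', Real.rpow_one]
    have key : ∀ {t A : ℝ}, 0 < t → 0 ≤ A →
        t ^ (1 - 1 / r) * A = t * (t ^ (1 / r))⁻¹ * A ∧ t * ((t ^ (1 / r))⁻¹ * A) ^ r = A ^ r := by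
      intro t A ht hA
      have ht' : 0 < t ^ (1 / r) := Real.rpow_pos_of_pos ht _
      refine ⟨?_, ?_⟩
      · nth_rewrite 2 [← hp' ht]
        field_simp
      · rw [Real.mul_rpow (by positivity) hA, Real.inv_rpow ht'.le, hp ht, ← mul_assoc,
          mul_inv_cancel₀ ht.ne', one_mul]
    have hmean : α ^ (1 - 1 / r) * A₁ + β ^ (1 - 1 / r) * A₂ ≤ (A₁ ^ r + A₂ ^ r) ^ (1 / r) := by
      have := (convexOn_rpow hr).2 (x := (α ^ (1 / r))⁻¹ * A₁) (y := (β ^ (1 / r))⁻¹ * A₂)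
        (Set.mem_Ici.2 (by positivity)) (Set.mem_Ici.2 (by positivity)) hα.le hβ.le hαβ
      simp only [smul_eq_mul] at this
      rw [(key hα hA₁0).2, (key hβ hA₂0).2] at this
      rw [(key hα hA₁0).1, (key hβ hA₂0).1, mul_assoc, mul_assoc, one_div r,
        Real.le_rpow_inv_iff_of_pos (by positivity) (by positivity) hr0]
      simpa only [one_div] using this
    have g₁ : ‖∑ k, a (Fin.castAdd n₂ k) • ((α ^ (1 - 1 / r) : ℝ) : 𝕜) • y₁ k‖ ≤
        α ^ (1 - 1 / r) * (c * A₁) := by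
      simp only [smul_comm _ ((α ^ (1 - 1 / r) : ℝ) : 𝕜)]
      rw [← Finset.smul_sum, norm_smul, RCLike.norm_ofReal, abs_of_nonneg (by positivity)]
      gcongr
      exact h₁ _
    have g₂ : ‖∑ k, a (Fin.natAdd n₁ k) • ((β ^ (1 - 1 / r) : ℝ) : 𝕜) • y₂ k‖ ≤
        β ^ (1 - 1 / r) * (c * A₂) := by
      simp only [smul_comm _ ((β ^ (1 - 1 / r) : ℝ) : 𝕜)]
      rw [← Finset.smul_sum, norm_smul, RCLike.norm_ofReal, abs_of_nonneg (by positivity)]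
      gcongr
      exact h₂ _
    rw [← e₁, ← e₂]
    calc _ ≤ α ^ (1 - 1 / r) * (c * A₁) + β ^ (1 - 1 / r) * (c * A₂) :=
          (norm_add_le _ _).trans (add_le_add g₁ g₂)
      _ = c * (α ^ (1 - 1 / r) * A₁ + β ^ (1 - 1 / r) * A₂) := by ring
      _ ≤ _ := by gcongr
  · simp only [Fin.sum_univ_add, Fin.append_left, Fin.append_right, LinearMap.smul_apply,
      smul_eq_mul]
    have e : ∀ {t : ℝ}, 0 < t → ∀ {n : ℕ} (ξ : Fin n → X →ₗ[𝕜] 𝕜) (y : Fin n → Y),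
        ∑ k, (((t ^ (1 / r) : ℝ) : 𝕜) * ξ k (x j)) • ((t ^ (1 - 1 / r) : ℝ) : 𝕜) • y k =
          (t : 𝕜) • ∑ k, ξ k (x j) • y k := fun {t} ht n ξ y => by
      rw [Finset.smul_sum]
      refine Finset.sum_congr rfl fun k _ => ?_
      rw [smul_smul, smul_smul, mul_right_comm, ← RCLike.ofReal_mul, hp' ht]
    rw [e hα, e hβ]
    have hT : T (x j) = (α : 𝕜) • T (x j) + (β : 𝕜) • T (x j) := by
      rw [← add_smul, ← RCLike.ofReal_add, hαβ, RCLike.ofReal_one, one_smul]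
    rw [hT, add_sub_add_comm, ← smul_sub, ← smul_sub]
    refine (norm_add_le _ _).trans ?_
    rw [norm_smul, norm_smul, RCLike.norm_ofReal, RCLike.norm_ofReal, abs_of_pos hα, abs_of_pos hβ]
    calc _ ≤ α * ε + β * ε := by
          gcongr
          exacts [h₁' j, h₂' j]
      _ = ε := by rw [← add_mul, hαβ, one_mul]
  · simp only [Fin.sum_univ_add, Fin.append_left, Fin.append_right, LinearMap.smul_apply,
      smul_eq_mul, norm_mul, RCLike.norm_ofReal]
    have e : ∀ {t : ℝ}, 0 < t → ∀ {n : ℕ} (ξ : Fin n → X →ₗ[𝕜] 𝕜),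
        ∑ k, (|t ^ (1 / r)| * ‖ξ k (x j)‖) ^ r = t * ∑ k, ‖ξ k (x j)‖ ^ r := fun {t} ht n ξ => by
      rw [Finset.mul_sum]
      refine Finset.sum_congr rfl fun k _ => ?_
      rw [abs_of_nonneg (by positivity), Real.mul_rpow (by positivity) (norm_nonneg _), hp ht]
    rw [e hα, e hβ]
    simp only [Pi.add_apply, Pi.smul_apply, smul_eq_mul]
    gcongr
    exacts [h₁'' j, h₂'' j]

/-- If the sum `∑ j ∑ k, ‖ξ k (w j)‖ ^ r` can be controlled for all finite families `w`, then it
can be controlled at each point individually: otherwise a hyperplane separates the convex set of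
dominating vectors from an open orthant, and its normal vector provides weights for which the
hypothesis fails. -/
theorem nonempty_approxFactorization (T : X →L[𝕜] Y) {r c : ℝ} (hr : 1 ≤ r) (hc : 0 ≤ c)
    (H : ∀ {m : ℕ} (w : Fin m → X) {δ : ℝ}, 0 < δ →
      ∃ (n : ℕ) (ξ : Fin n → X →ₗ[𝕜] 𝕜) (y : Fin n → Y),
        (∀ a : Fin n → 𝕜, ‖∑ k, a k • y k‖ ≤ c * (∑ k, ‖a k‖ ^ r) ^ (1 / r)) ∧
        (∀ j, ‖∑ k, ξ k (w j) • y k - T (w j)‖ ≤ δ) ∧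
        ∑ j, ∑ k, ‖ξ k (w j)‖ ^ r ≤ ∑ j, ‖w j‖ ^ r + δ)
    (s : Finset X) {ε : ℝ} (hε : 0 < ε) : Nonempty (ApproxFactorization T r c s ε) := by
  have hr0 : 0 < r := zero_lt_one.trans_le hr
  let x : Fin s.card → X := fun j => (s.equivFin.symm j : X)
  let O : Set (Fin s.card → ℝ) := Set.univ.pi fun j => Set.Iio (‖x j‖ ^ r + ε)
  have hOo : IsOpen O := isOpen_set_pi Set.finite_univ fun _ _ => isOpen_Iio
  have hOc : Convex ℝ O := convex_pi fun _ _ => convex_Iio _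
  by_cases hdisj : Disjoint O (dominatingVectors T r c ε x)
  swap
  · obtain ⟨v, hv, n, ξ, y, h1, h2, h3⟩ := Set.not_disjoint_iff.1 hdisj
    have hx : ∀ z (hz : z ∈ s), x (s.equivFin ⟨z, hz⟩) = z := fun z hz => by simp [x]
    refine ⟨⟨n, ξ, y, h1, fun z hz => ?_, fun z hz => ?_⟩⟩
    · rw [← hx z hz]
      exact (h3 _).trans (hv _ (Set.mem_univ _)).le
    · rw [← hx z hz]
      exact h2 _
  exfalso
  obtain ⟨f, u, hfO, hfN⟩ := geometric_hahn_banach_open hOc hOo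
    (convex_dominatingVectors T hr hc ε x) hdisj
  let l : Fin s.card → ℝ := fun j => f (Pi.single j 1)
  have hfl : ∀ v, f v = ∑ j, l j * v j := fun v => by
    conv_lhs => rw [← Finset.univ_sum_single v, map_sum]
    refine Finset.sum_congr rfl fun j _ => ?_
    have : Pi.single j (v j) = v j • (Pi.single j 1 : Fin s.card → ℝ) := by
      rw [← Pi.single_smul, smul_eq_mul, mul_one]
    rw [this, map_smul, smul_eq_mul, mul_comm]
  have hO₀ : (fun j => ‖x j‖ ^ r) ∈ O := fun j _ => lt_add_of_pos_right _ hε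
  have hl : ∀ j, 0 ≤ l j := fun j => by
    by_contra! hneg
    -- Moving from a point of the orthant in the direction `-e_j` stays in the orthant.
    obtain ⟨t, ht⟩ := exists_nat_gt ((u - f fun j => ‖x j‖ ^ r) / -l j)
    have hmem : ((fun j => ‖x j‖ ^ r) - (t : ℝ) • Pi.single j 1 : Fin s.card → ℝ) ∈ O := fun i _ => by
      have : 0 ≤ (t : ℝ) * (Pi.single j 1 : Fin s.card → ℝ) i :=
        by
        rcases eq_or_ne i j with rfl | hij
        · simp
        · simp [hij]
      have h2 : ‖x i‖ ^ r - (t : ℝ) * (Pi.single j 1 : Fin s.card → ℝ) i < ‖x i‖ ^ r + ε := by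
        linarith
      exact h2
    have h1 := hfO _ hmem
    rw [map_sub, map_smul, smul_eq_mul] at h1
    rw [div_lt_iff₀ (by linarith)] at ht
    change f _ - t * l j < u at h1
    linarith
  set R : ℝ := ∑ j, ‖x j‖ ^ r with hR
  have hR0 : 0 ≤ R := by positivity
  set gap : ℝ := u - f fun j => ‖x j‖ ^ r with hgap
  have hgap0 : 0 < gap := sub_pos.2 (hfO _ hO₀)
  set t : ℝ := gap / (2 * (R + 1)) with ht
  have ht0 : 0 < t := by positivity
  set δ : ℝ := min (gap / 4) (ε * t ^ (1 / r)) with hδ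
  have hδ0 : 0 < δ := lt_min (by positivity) (by positivity)
  have hlt : ∀ j, 0 < l j + t := fun j => add_pos_of_nonneg_of_pos (hl j) ht0
  have hpow : ∀ j, ((l j + t) ^ (1 / r)) ^ r = l j + t := fun j => by
    rw [← Real.rpow_mul (hlt j).le, one_div_mul_cancel hr0.ne', Real.rpow_one]
  obtain ⟨n, ξ, y, h1, h2, h3⟩ := H (fun j => (((l j + t) ^ (1 / r) : ℝ) : 𝕜) • x j) hδ0
  have hmem : (fun j => ∑ k, ‖ξ k (x j)‖ ^ r) ∈ dominatingVectors T r c ε x := by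
    refine ⟨n, ξ, y, h1, fun j => ?_, fun j => le_rfl⟩
    have h4 := h2 j
    simp only [map_smul, smul_assoc, ← Finset.smul_sum, ← smul_sub] at h4
    rw [norm_smul, RCLike.norm_ofReal, abs_of_nonneg (by have := hlt j; positivity)] at h4
    have h5 : t ^ (1 / r) ≤ (l j + t) ^ (1 / r) := by
      gcongr
      linarith [hl j]
    have h6 : 0 < t ^ (1 / r) := by positivity
    have h7 := ((mul_le_mul_of_nonneg_right h5 (norm_nonneg _)).trans h4).trans
      ((min_le_right _ _).trans_eq (mul_comm _ _))
    exact le_of_mul_le_mul_left h7 h6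
  have h4 := hfN _ hmem
  have h5 : ∀ j k, ‖ξ k ((((l j + t) ^ (1 / r) : ℝ) : 𝕜) • x j)‖ ^ r =
      (l j + t) * ‖ξ k (x j)‖ ^ r := fun j k => by
    have := hlt j
    rw [map_smul, norm_smul, RCLike.norm_ofReal, abs_of_nonneg (by positivity),
      Real.mul_rpow (by positivity) (norm_nonneg _), hpow]
  have h6 : ∀ j, ‖(((l j + t) ^ (1 / r) : ℝ) : 𝕜) • x j‖ ^ r = (l j + t) * ‖x j‖ ^ r := fun j => by
    have := hlt j
    rw [norm_smul, RCLike.norm_ofReal, abs_of_nonneg (by positivity),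
      Real.mul_rpow (by positivity) (norm_nonneg _), hpow]
  simp only [h5, h6, ← Finset.mul_sum] at h3
  have h7 : f (fun j => ∑ k, ‖ξ k (x j)‖ ^ r) ≤ ∑ j, (l j + t) * ∑ k, ‖ξ k (x j)‖ ^ r := by
    rw [hfl]
    gcongr with j
    linarith
  have h8 : ∑ j, (l j + t) * ‖x j‖ ^ r = f (fun j => ‖x j‖ ^ r) + t * R := by
    rw [hfl, hR, Finset.mul_sum, ← Finset.sum_add_distrib]
    exact Finset.sum_congr rfl fun j _ => add_mul _ _ _
  have h9 : t * R ≤ gap / 2 := by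
    rw [ht, div_mul_eq_mul_div, div_le_div_iff₀ (by positivity) two_pos]
    nlinarith
  have h10 : δ ≤ gap / 4 := min_le_left _ _
  linarith

end Convexity

/-! ### The factorization theorem -/

/-- The conclusion with arbitrary admissible constants in place of the optimal ones. -/
theorem gammaNorm_toBidual_le {𝕜 : Type} [RCLike 𝕜]
    {X Y : Type u} [NormedAddCommGroup X] [NormedSpace 𝕜 X]
    [NormedAddCommGroup Y] [NormedSpace 𝕜 Y]
    {p q : ℝ≥0∞} [Fact (1 ≤ p)] (hp : p ≠ ∞) (hpq : p.HolderConjugate q)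
    {C K : ℝ≥0} (hC : ∀ U : EllInfty 𝕜 →L[𝕜] StrongDual 𝕜 X, summingNorm q U ≤ C * ‖U‖ₑ)
    (hK : GLBound 𝕜 Y 1 p K) (T : X →L[𝕜] Y) :
    FactorsThroughLp (𝕜 := 𝕜) (X := X) (Y := StrongDual 𝕜 (StrongDual 𝕜 Y)) p (toBidual T) ∧
      gammaNorm (𝕜 := 𝕜) (X := X) (Y := StrongDual 𝕜 (StrongDual 𝕜 Y)) p (toBidual T) ≤
        C * K * ‖T‖ₑ := by
  have : Fact (1 ≤ q) := ⟨ENNReal.HolderConjugate.one_le q p⟩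
  have hr : 1 ≤ p.toReal := by
    simpa using ENNReal.toReal_mono hp (Fact.out : (1 : ℝ≥0∞) ≤ p)
  have h : ∀ c : ℝ, K * C * ‖T‖ < c →
      FactorsThroughLp (𝕜 := 𝕜) (X := X) (Y := StrongDual 𝕜 (StrongDual 𝕜 Y)) p (toBidual T) ∧
      gammaNorm (𝕜 := 𝕜) (X := X) (Y := StrongDual 𝕜 (StrongDual 𝕜 Y)) p (toBidual T) ≤
        ENNReal.ofReal c := fun c hc => by
    have hc0 : 0 ≤ c := (lt_of_le_of_lt (by positivity) hc).le
    exact gammaNorm_toBidual_le_of_approxFactorization T p hp hc0 fun s ε hε =>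
      nonempty_approxFactorization T hr hc0
        (fun w _ hδ => exists_local_factorization hpq hp hC hK T hc w hδ) s hε
  refine ⟨(h _ (lt_add_one _)).1, ENNReal.le_of_forall_pos_le_add fun ε hε _ => ?_⟩
  refine (h (K * C * ‖T‖ + ε) (lt_add_of_pos_right _ hε)).2.trans (ENNReal.ofReal_add_le.trans ?_)
  rw [ENNReal.ofReal_coe_nnreal, ENNReal.ofReal_mul (by positivity),
    ENNReal.ofReal_mul K.coe_nonneg, ENNReal.ofReal_coe_nnreal, ENNReal.ofReal_coe_nnreal,
    ofReal_norm, mul_comm (K : ℝ≥0∞)]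

end

end BanachOp

theorem theorem3p1 {𝕜 : Type} [RCLike 𝕜]
    {X Y : Type u} [NormedAddCommGroup X] [NormedSpace 𝕜 X] [CompleteSpace X]
    [NormedAddCommGroup Y] [NormedSpace 𝕜 Y] [CompleteSpace Y]
    (p p' : ℝ≥0∞) [Fact (1 ≤ p)] (hp : p ≤ 2) (hpp' : p.HolderConjugate p')
    (hX : ∀ U : BanachOp.EllInfty 𝕜 →L[𝕜] StrongDual 𝕜 X, BanachOp.IsSumming p' U)
    (hY : BanachOp.HasGL 𝕜 Y 1 p) :
    BanachOp.ellInftySummingConst 𝕜 (StrongDual 𝕜 X) p' < ∞ ∧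
    ∀ T : X →L[𝕜] Y,
      BanachOp.FactorsThroughLp (𝕜 := 𝕜) (X := X) (Y := StrongDual 𝕜 (StrongDual 𝕜 Y)) p (BanachOp.toBidual T) ∧
      BanachOp.gammaNorm (𝕜 := 𝕜) (X := X) (Y := StrongDual 𝕜 (StrongDual 𝕜 Y)) p (BanachOp.toBidual T) ≤
        BanachOp.ellInftySummingConst 𝕜 (StrongDual 𝕜 X) p' * BanachOp.GLConst 𝕜 Y 1 p * ‖T‖ₑ := by
  have hp' : p ≠ ∞ := (hp.trans_lt ENNReal.ofNat_lt_top).ne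
  have hlt : BanachOp.ellInftySummingConst 𝕜 (StrongDual 𝕜 X) p' < ∞ :=
    BanachOp.ellInftySummingConst_lt_top (ENNReal.HolderConjugate.one_le p' p) hX
  obtain ⟨K₀, hK₀⟩ := hY
  obtain ⟨C₀, hC₀⟩ := BanachOp.exists_summingNorm_le_mul_enorm
    (ENNReal.HolderConjugate.one_le p' p) hX
  have hGL : BanachOp.GLConst 𝕜 Y 1 p < ∞ := (iInf₂_le K₀ hK₀).trans_lt ENNReal.coe_lt_top
  refine ⟨hlt, fun T => ⟨(BanachOp.gammaNorm_toBidual_le hp' hpp' hC₀ hK₀ T).1, ?_⟩⟩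
  set γ := BanachOp.gammaNorm (𝕜 := 𝕜) (X := X) (Y := StrongDual 𝕜 (StrongDual 𝕜 Y)) p
    (BanachOp.toBidual T) with hγ
  rw [mul_assoc]
  refine ENNReal.le_mul_of_forall_lt (Or.inr (ENNReal.mul_ne_top hGL.ne enorm_ne_top))
    (Or.inl hlt.ne) fun a ha b hb => ?_
  simp only [gt_iff_lt, BanachOp.ellInftySummingConst, iInf_lt_iff] at ha
  obtain ⟨C, hC, hCa⟩ := ha
  refine le_trans ?_ (mul_le_mul' hCa.le hb.le)
  rw [mul_left_comm]
  refine ENNReal.le_mul_of_forall_lt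
    (Or.inr (ENNReal.mul_ne_top ENNReal.coe_ne_top enorm_ne_top)) (Or.inl hGL.ne)
    fun a ha b hb => ?_
  simp only [gt_iff_lt, BanachOp.GLConst, iInf_lt_iff] at ha
  obtain ⟨K, hK, hKa⟩ := ha
  refine le_trans ?_ (mul_le_mul' hKa.le hb.le)
  rw [mul_left_comm, ← mul_assoc]
  exact (BanachOp.gammaNorm_toBidual_le hp' hpp' hC hK T).2
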